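/- Let $\Omega=(a,b)$ be a bounded open interval with $a<b$, $|\Omega|=b-a$, and let $s\in(0,1)$. Let $\lambda_k=(k\pi/|\Omega|)^2$, $k\ge 0$, be the eigenvalues and $\varphi_k$ the $L^2(\Omega)$-normalized eigenfunctions of $-\partial_{xx}$ on $\Omega$ with Neumann boundary conditions, that is $\varphi_0=|\Omega|^{-1/2}$ and $\varphi_k(x)=\sqrt{2/|\Omega|}\,\cos(k\pi(x-a)/|\Omega|)$ for $k\ge1$. For $v\in L^2(\Omega)$ put $c_k=\int_\Omega v\varphi_k\,dx$; write $v\in H^{r}_N(\Omega)$ if $\sum_k c_k^2(1+\lambda_k^r)<\infty$, and, for $\sigma>0$ and $v\in H^{2\sigma}_N(\Omega)$, put $(-\Delta)^{\sigma}v=\sum_k\lambda_k^{\sigma}c_k\varphi_k\in L^2(\Omega)$. Let $v\in H^{2s+1}_N(\Omega)$ with $v\ge0$ a.e. in $\Omega$. Then $(-\Delta)^s v$ has a weak derivative $\partial_x(-\Delta)^s v\in L^2(\Omega)$, and for every measurable $w:\Omega\to[0,\infty)$ $$\int_\Omega \frac{v^2}{w}\,dx\;\int_\Omega w\,\bigl|\partial_x(-\Delta)^s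 v\bigr|^2\,dx\;\ge\;\frac{1}{4|\Omega|^2}\left(\int_\Omega \bigl|(-\Delta)^{s/2}v\bigr|^2\,dx\right)^2 .$$ Here the integrals on the left are taken in $[0,\infty]$, with $v^2/w=+\infty$ where $w=0<v$ and $v^2/w=0$ where $w=v=0$; the inequality is claimed whenever the product on the left is not of the indeterminate form $\infty\cdot0$. -/

import Mathlib

open MeasureTheory Set
open scoped ENNReal NNReal ContDiff

/-- The `k`-th eigenvalue `(kπ/|Ω|)²` of the Neumann Laplacian `-∂ₓₓ` on `Ω = (a, b)`. -/
noncomputable def neumannEigenvalue (a b : ℝ) (k : ℕ) : ℝ :=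
  (k * Real.pi / (b - a)) ^ 2

/-- The `k`-th `L²`-normalized eigenfunction of the Neumann Laplacian on `Ω = (a, b)`: the constant
`1/√|Ω|` for `k = 0`, and `√(2/|Ω|) cos(kπ(x - a)/|Ω|)` for `k ≥ 1`. -/
noncomputable def neumannEigenfunction (a b : ℝ) (k : ℕ) (x : ℝ) : ℝ :=
  (if k = 0 then 1 / Real.sqrt (b - a) else Real.sqrt (2 / (b - a))) *
    Real.cos (k * Real.pi * (x - a) / (b - a))

theorem memLp_neumannEigenfunction (a b : ℝ) (k : ℕ) :
    MemLp (neumannEigenfunction a b k) 2 (volume.restrict (Ioo a b)) := by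
  have hc : Continuous (neumannEigenfunction a b k) := by
    unfold neumannEigenfunction
    fun_prop
  refine MemLp.of_bound hc.aestronglyMeasurable
    |if k = 0 then 1 / Real.sqrt (b - a) else Real.sqrt (2 / (b - a))|
    (Filter.Eventually.of_forall fun x => ?_)
  rw [neumannEigenfunction, Real.norm_eq_abs, abs_mul]
  exact mul_le_of_le_one_right (abs_nonneg _) (Real.abs_cos_le_one _)

/-- The coefficient `c_k = ⟨v, φ_k⟩` of `v` in the expansion `v = ∑ c_k φ_k` in `L²(a, b)`. -/
noncomputable def neumannCoeff (a b : ℝ) (v : ℝ → ℝ) (k : ℕ) : ℝ :=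
  ∫ x in Ioo a b, v x * neumannEigenfunction a b k x

/-- `v ∈ H^r_N(a, b)`: `v ∈ L²(a, b)` and `∑ c_k² (1 + λ_k^r) < ∞`.
(The eigenfunctions form a Hilbert basis of `L²(a, b)`, so `v = ∑ c_k φ_k`.) -/
def MemHN (a b r : ℝ) (v : ℝ → ℝ) : Prop :=
  MemLp v 2 (volume.restrict (Ioo a b)) ∧
    Summable fun k : ℕ => neumannCoeff a b v k ^ 2 * (1 + neumannEigenvalue a b k ^ r)

/-- The spectral Neumann fractional Laplacian `(-Δ)^s v = ∑ λ_k^s c_k φ_k`, the series being taken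
in `L²(a, b)`. It converges there exactly when `∑ λ_k^{2s} c_k² < ∞`, in particular for
`v ∈ H^{2s}_N(a, b)`. -/
noncomputable def neumannFracLaplacian (a b s : ℝ) (v : ℝ → ℝ) :
    Lp ℝ 2 (volume.restrict (Ioo a b)) :=
  ∑' k : ℕ, (neumannEigenvalue a b k ^ s * neumannCoeff a b v k) •
    (memLp_neumannEigenfunction a b k).toLp (neumannEigenfunction a b k)

/-- `h` is the weak (distributional) derivative of `g` on the open interval `(a, b)`. -/
def HasWeakDerivOn (a b : ℝ) (g h : ℝ → ℝ) : Prop :=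
  LocallyIntegrableOn g (Ioo a b) ∧ LocallyIntegrableOn h (Ioo a b) ∧
    ∀ φ : ℝ → ℝ, ContDiff ℝ ∞ φ → HasCompactSupport φ → tsupport φ ⊆ Ioo a b →
      ∫ x in Ioo a b, g x * deriv φ x = - ∫ x in Ioo a b, h x * φ x

/-! The heart is a virial estimate. Let `m` be the minimum over `[a, b]` of the continuous
representative of `v`, attained at `x₀`, and put `u = v - m`. Then `u ≥ 0`, `u(x₀) = 0`, and the
subtracted constant is invisible to `(-Δ)^{s/2}` and `∂ₓ(-Δ)^s`. Let `ψ` be the sawtooth with `ψ' =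
1 - |Ω| δ_{x₀}` that vanishes at the ends of `Ω`. The estimate is `-∫ ψ u ∂ₓ(-Δ)^s u ≥ 1/2 ∫
|(-Δ)^{s/2} u|²`. Since `|ψ| ≤ |Ω|` and `0 ≤ u ≤ v`, it bounds `∫ |v ∂ₓ(-Δ)^s v|` below by `1/(2|Ω|)
∫ |(-Δ)^{s/2} v|²`, and the weighted Cauchy–Schwarz inequality `lintegral_mul_sq_le_weighted`
finishes.

For the estimate, `λ^s` is a positive superposition over `t > 0` of `λ/(t+λ) = 1 - t/(t+λ)`
(`tsum_rpow_mul_nonneg`), so it suffices to compare the identity with the resolvent `w = t(t-Δ)⁻¹u`.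
For the identity, `-∫ ψ u u' = 1/2 ∫ u²`, because `u(x₀) = 0` (`tsum_sawtooth_eq_zero`). For the
resolvent, `r²w - w'' = r²u` with `r² = t` makes `u w'` the derivative of `F = (w² - w'²/r²)/2`,
whence `∫ ψ u w' + 1/2 ∫ u w = |Ω| F(x₀) + ∫ w'²/r²`. Positivity of `u` gives `|w'| ≤ r w`
(`sq_deriv_le_of_resolvent`), so `F(x₀) ≥ 0` and the sum is nonnegative.

These facts are expressed in coefficients: with `β_k = ∫ ψ u s_k`, where `s_k` are the Dirichlet
sines, and `d_k = √λ_k c_k β_k - c_k²/2`, they read `∑ d_k = 0` and `∑ t/(t+λ_k) d_k ≤ 0`, and they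
yield `∑ λ_k^s d_k ≥ 0`. -/

theorem integral_Ioo_eq_intervalIntegral {a b : ℝ} (hab : a ≤ b) (f : ℝ → ℝ) :
    ∫ x in Ioo a b, f x = ∫ x in a..b, f x := by
  rw [intervalIntegral.integral_of_le hab, integral_Ioc_eq_integral_Ioo]

/-! ### Neumann and Dirichlet eigenfunctions -/

/-- The square root `kπ/|Ω|` of the `k`-th Neumann eigenvalue. -/
noncomputable def neumannFreq (a b : ℝ) (k : ℕ) : ℝ := k * Real.pi / (b - a)

/-- The `L²`-normalized Dirichlet eigenfunction `√(2/|Ω|) sin(kπ(x - a)/|Ω|)`. -/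
noncomputable def dirichletEigenfunction (a b : ℝ) (k : ℕ) (x : ℝ) : ℝ :=
  Real.sqrt (2 / (b - a)) * Real.sin (k * Real.pi * (x - a) / (b - a))

theorem neumannEigenvalue_eq (a b : ℝ) (k : ℕ) :
    neumannEigenvalue a b k = neumannFreq a b k ^ 2 := rfl

theorem neumannEigenvalue_nonneg (a b : ℝ) (k : ℕ) : 0 ≤ neumannEigenvalue a b k :=
  sq_nonneg _

theorem neumannEigenvalue_zero (a b : ℝ) : neumannEigenvalue a b 0 = 0 := by
  simp [neumannEigenvalue]

theorem neumannFreq_zero (a b : ℝ) : neumannFreq a b 0 = 0 := by simp [neumannFreq]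

theorem neumannFreq_nonneg {a b : ℝ} (hab : a < b) (k : ℕ) : 0 ≤ neumannFreq a b k := by
  have := sub_pos.2 hab
  unfold neumannFreq
  positivity

theorem dirichletEigenfunction_zero (a b x : ℝ) : dirichletEigenfunction a b 0 x = 0 := by
  simp [dirichletEigenfunction]

theorem hasDerivAt_neumann_phase (a b : ℝ) (k : ℕ) (x : ℝ) :
    HasDerivAt (fun y => k * Real.pi * (y - a) / (b - a)) (neumannFreq a b k) x := by
  have h := (((hasDerivAt_id x).sub_const a).const_mul (k * Real.pi)).div_const (b - a)
  simpa [neumannFreq] using h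

theorem hasDerivAt_neumannEigenfunction (a b : ℝ) (k : ℕ) (x : ℝ) :
    HasDerivAt (neumannEigenfunction a b k)
      (-(neumannFreq a b k * dirichletEigenfunction a b k x)) x := by
  have h := ((hasDerivAt_neumann_phase a b k x).cos).const_mul
    (if k = 0 then 1 / Real.sqrt (b - a) else Real.sqrt (2 / (b - a)))
  refine h.congr_deriv ?_
  rcases eq_or_ne k 0 with rfl | hk
  · simp [neumannFreq]
  · simp only [hk, if_false, dirichletEigenfunction]
    ring

theorem hasDerivAt_dirichletEigenfunction (a b : ℝ) (k : ℕ) (x : ℝ) :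
    HasDerivAt (dirichletEigenfunction a b k)
      (neumannFreq a b k * neumannEigenfunction a b k x) x := by
  have h := ((hasDerivAt_neumann_phase a b k x).sin).const_mul (Real.sqrt (2 / (b - a)))
  refine h.congr_deriv ?_
  rcases eq_or_ne k 0 with rfl | hk
  · simp [neumannFreq]
  · simp only [hk, if_false, neumannEigenfunction]
    ring

theorem continuous_neumannEigenfunction (a b : ℝ) (k : ℕ) :
    Continuous (neumannEigenfunction a b k) := by
  unfold neumannEigenfunction
  fun_prop

theorem continuous_dirichletEigenfunction (a b : ℝ) (k : ℕ) :
    Continuous (dirichletEigenfunction a b k) := by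
  unfold dirichletEigenfunction
  fun_prop

theorem abs_neumannEigenfunction_le {a b : ℝ} (hab : a < b) (k : ℕ) (x : ℝ) :
    |neumannEigenfunction a b k x| ≤ Real.sqrt (2 / (b - a)) := by
  have hL := sub_pos.2 hab
  rw [neumannEigenfunction, abs_mul]
  refine (mul_le_of_le_one_right (abs_nonneg _) (Real.abs_cos_le_one _)).trans ?_
  split_ifs
  · rw [abs_of_nonneg (by positivity), ← Real.sqrt_one, ← Real.sqrt_div zero_le_one]
    apply Real.sqrt_le_sqrt
    gcongr
    norm_num
  · rw [abs_of_nonneg (by positivity)]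

theorem abs_dirichletEigenfunction_le (a b : ℝ) (k : ℕ) (x : ℝ) :
    |dirichletEigenfunction a b k x| ≤ Real.sqrt (2 / (b - a)) := by
  rw [dirichletEigenfunction, abs_mul, abs_of_nonneg (Real.sqrt_nonneg _)]
  exact mul_le_of_le_one_right (Real.sqrt_nonneg _) (Real.abs_sin_le_one _)

theorem dirichletEigenfunction_left (a b : ℝ) (k : ℕ) : dirichletEigenfunction a b k a = 0 := by
  simp [dirichletEigenfunction]

theorem dirichletEigenfunction_right {a b : ℝ} (hab : a < b) (k : ℕ) :
    dirichletEigenfunction a b k b = 0 := by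
  have hL := (sub_pos.2 hab).ne'
  simp [dirichletEigenfunction, hL, Real.sin_nat_mul_pi]

/-! ### Orthonormality -/

theorem integral_cos_int_mul {a b : ℝ} (hab : a < b) (n : ℤ) :
    ∫ x in a..b, Real.cos (n * (Real.pi * (x - a) / (b - a))) = if n = 0 then b - a else 0 := by
  have hL := (sub_pos.2 hab).ne'
  split_ifs with hn
  · simp [hn]
  have hn' : (n : ℝ) ≠ 0 := by exact_mod_cast hn
  have hd : ∀ x : ℝ, HasDerivAt
      (fun y => (b - a) / (n * Real.pi) * Real.sin (n * (Real.pi * (y - a) / (b - a))))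
      (Real.cos (n * (Real.pi * (x - a) / (b - a)))) x := fun x => by
    have h := (((((hasDerivAt_id x).sub_const a).const_mul Real.pi).div_const (b - a)).const_mul
      (n : ℝ)).sin.const_mul ((b - a) / (n * Real.pi))
    refine h.congr_deriv ?_
    simp only [id]
    field_simp [Real.pi_ne_zero]
  rw [intervalIntegral.integral_eq_sub_of_hasDerivAt (fun x _ => hd x)
    (Continuous.intervalIntegrable (by fun_prop) _ _)]
  simp [hL, Real.sin_int_mul_pi]

/-- Product-to-sum form of both orthogonality relations: `ε = 1` serves the cosines, `ε = -1` the
sines. -/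
theorem integral_cos_mul_cos_add {a b : ℝ} (hab : a < b) (j k : ℕ) (ε : ℝ) :
    ∫ x in a..b, (Real.cos (((j : ℤ) - k : ℤ) * (Real.pi * (x - a) / (b - a)))
      + ε * Real.cos (((j : ℤ) + k : ℤ) * (Real.pi * (x - a) / (b - a)))) =
    (if j = k then b - a else 0) + ε * (if j = 0 ∧ k = 0 then b - a else 0) := by
  rw [intervalIntegral.integral_add (Continuous.intervalIntegrable (by fun_prop) _ _)
    (Continuous.intervalIntegrable (by fun_prop) _ _), intervalIntegral.integral_const_mul,
    integral_cos_int_mul hab, integral_cos_int_mul hab]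
  congr 2
  · simp [sub_eq_zero]
  · congr 1
    simp only [eq_iff_iff]
    omega

theorem integral_neumannEigenfunction_mul {a b : ℝ} (hab : a < b) (j k : ℕ) :
    ∫ x in a..b, neumannEigenfunction a b j x * neumannEigenfunction a b k x =
      if j = k then 1 else 0 := by
  have hL := sub_pos.2 hab
  set A : ℕ → ℝ := fun k => if k = 0 then 1 / Real.sqrt (b - a) else Real.sqrt (2 / (b - a))
    with hA
  have h : ∀ x, neumannEigenfunction a b j x * neumannEigenfunction a b k x =
      A j * A k / 2 * (Real.cos (((j : ℤ) - k : ℤ) * (Real.pi * (x - a) / (b - a)))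
      + 1 * Real.cos (((j : ℤ) + k : ℤ) * (Real.pi * (x - a) / (b - a)))) := fun x => by
    have e1 : (((j : ℤ) - k : ℤ) : ℝ) * (Real.pi * (x - a) / (b - a)) =
      j * Real.pi * (x - a) / (b - a) - k * Real.pi * (x - a) / (b - a) := by push_cast; ring
    have e2 : (((j : ℤ) + k : ℤ) : ℝ) * (Real.pi * (x - a) / (b - a)) =
      j * Real.pi * (x - a) / (b - a) + k * Real.pi * (x - a) / (b - a) := by push_cast; ring
    rw [e1, e2, Real.cos_sub, Real.cos_add]
    simp only [neumannEigenfunction, hA]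
    ring
  simp_rw [h]
  rw [intervalIntegral.integral_const_mul, integral_cos_mul_cos_add hab]
  rcases eq_or_ne j k with rfl | hjk
  · rcases eq_or_ne j 0 with rfl | hj
    · have := Real.mul_self_sqrt hL.le
      have h2 : Real.sqrt (b - a) ≠ 0 := (Real.sqrt_pos.2 hL).ne'
      simp only [hA, if_true, and_self]
      field_simp
      nlinarith
    · have : Real.sqrt (2 / (b - a)) * Real.sqrt (2 / (b - a)) = 2 / (b - a) :=
        Real.mul_self_sqrt (by positivity)
      simp only [hA, hj, if_false, if_true, and_self, this]
      field_simp
      simp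
  · have : ¬ (j = 0 ∧ k = 0) := fun h => hjk (h.1.trans h.2.symm)
    simp [hjk, this]

theorem integral_dirichletEigenfunction_mul {a b : ℝ} (hab : a < b) {j k : ℕ} (hk : k ≠ 0) :
    ∫ x in a..b, dirichletEigenfunction a b j x * dirichletEigenfunction a b k x =
      if j = k then 1 else 0 := by
  have hL := sub_pos.2 hab
  have h2 : Real.sqrt (2 / (b - a)) * Real.sqrt (2 / (b - a)) = 2 / (b - a) :=
    Real.mul_self_sqrt (by positivity)
  have h : ∀ x, dirichletEigenfunction a b j x * dirichletEigenfunction a b k x =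
      (b - a)⁻¹ * (Real.cos (((j : ℤ) - k : ℤ) * (Real.pi * (x - a) / (b - a)))
      + (-1) * Real.cos (((j : ℤ) + k : ℤ) * (Real.pi * (x - a) / (b - a)))) := fun x => by
    have e1 : (((j : ℤ) - k : ℤ) : ℝ) * (Real.pi * (x - a) / (b - a)) =
      j * Real.pi * (x - a) / (b - a) - k * Real.pi * (x - a) / (b - a) := by push_cast; ring
    have e2 : (((j : ℤ) + k : ℤ) : ℝ) * (Real.pi * (x - a) / (b - a)) =
      j * Real.pi * (x - a) / (b - a) + k * Real.pi * (x - a) / (b - a) := by push_cast; ring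
    rw [e1, e2, Real.cos_sub, Real.cos_add]
    simp only [dirichletEigenfunction]
    rw [mul_mul_mul_comm, h2]
    field_simp
    ring
  simp_rw [h]
  rw [intervalIntegral.integral_const_mul, integral_cos_mul_cos_add hab]
  split_ifs with h1 h3 h4 <;> first | omega | simp [hL.ne']

/-! ### Completeness of the cosines -/

/-- Orthogonality to every `cos kθ` passes to polynomials in `cos θ`. As `cos θ` maps `[a, b]`
homeomorphically onto `[-1, 1]`, Weierstrass approximation extends it to all continuous functions,
test functions included. -/
theorem ae_eq_zero_of_neumannCoeff_eq_zero {a b : ℝ} (hab : a < b) {f : ℝ → ℝ}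
    (hf : IntegrableOn f (Ioo a b)) (h0 : ∀ k, neumannCoeff a b f k = 0) :
    ∀ᵐ x ∂(volume.restrict (Ioo a b)), f x = 0 := by
  have hL := sub_pos.2 hab
  set θ : ℝ → ℝ := fun x => Real.pi * (x - a) / (b - a) with hθ
  have hθc : Continuous θ := by fun_prop
  have hint : ∀ g : ℝ → ℝ, Continuous g → (∃ C, ∀ x ∈ Ioo a b, |g x| ≤ C) →
      Integrable (fun x => f x * g x) (volume.restrict (Ioo a b)) := by
    rintro g hg ⟨C, hC⟩
    refine Integrable.mul_bdd (c := C) hf hg.aestronglyMeasurable ?_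
    exact (ae_restrict_iff' measurableSet_Ioo).2 (.of_forall hC)
  have hbd : ∀ g : ℝ → ℝ, Continuous g → ∃ C, ∀ x ∈ Ioo a b, |g x| ≤ C := fun g hg => by
    obtain ⟨C, hC⟩ := isCompact_Icc.exists_bound_of_continuousOn (s := Icc a b) hg.continuousOn
    exact ⟨C, fun x hx => hC x (Ioo_subset_Icc_self hx)⟩
  have hcos : ∀ k : ℕ, ∫ x in Ioo a b, f x * Real.cos (k * θ x) = 0 := fun k => by
    set A : ℝ := if k = 0 then 1 / Real.sqrt (b - a) else Real.sqrt (2 / (b - a)) with hA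
    have hA0 : A ≠ 0 := by
      rw [hA]
      split_ifs <;> positivity
    have h := h0 k
    have e : ∀ x, f x * neumannEigenfunction a b k x = A * (f x * Real.cos (k * θ x)) := fun x => by
      rw [neumannEigenfunction, ← hA, hθ]
      ring_nf
    rw [neumannCoeff] at h
    simp_rw [e] at h
    rw [integral_const_mul] at h
    exact (mul_eq_zero.1 h).resolve_left hA0
  have hpow : ∀ n k : ℕ, ∫ x in Ioo a b, f x * (Real.cos (θ x) ^ n * Real.cos (k * θ x)) = 0 := by
    intro n
    induction n with
    | zero => intro k; simpa using hcos k
    | succ n ih =>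
      intro k
      rcases k with _ | k
      · have := ih 1
        simpa [pow_succ] using this
      -- The identity `cos θ cos (k+1)θ = (cos kθ + cos (k+2)θ)/2` trades one power of `cos θ` for a
      -- shift of the frequency.
      · have e : ∀ x, f x * (Real.cos (θ x) ^ (n + 1) * Real.cos ((k + 1 : ℕ) * θ x)) =
            1 / 2 * (f x * (Real.cos (θ x) ^ n * Real.cos (k * θ x)))
            + 1 / 2 * (f x * (Real.cos (θ x) ^ n * Real.cos ((k + 2 : ℕ) * θ x))) := fun x => by
          have e1 : (k : ℝ) * θ x = (k + 1 : ℕ) * θ x - θ x := by push_cast; ring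
          have e2 : ((k + 2 : ℕ) : ℝ) * θ x = (k + 1 : ℕ) * θ x + θ x := by push_cast; ring
          rw [e1, e2, Real.cos_sub, Real.cos_add]
          ring
        have hi : ∀ m : ℕ, Integrable (fun x => 1 / 2 * (f x * (Real.cos (θ x) ^ n *
            Real.cos (m * θ x)))) (volume.restrict (Ioo a b)) := fun m => by
          have hc : Continuous fun x => Real.cos (θ x) ^ n * Real.cos (m * θ x) := by fun_prop
          exact (hint _ hc (hbd _ hc)).const_mul _
        simp_rw [e]
        rw [integral_add (hi k) (hi (k + 2)), integral_const_mul, integral_const_mul, ih, ih]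
        simp
  have hpoly : ∀ p : Polynomial ℝ, ∫ x in Ioo a b, f x * p.eval (Real.cos (θ x)) = 0 := fun p => by
    simp_rw [Polynomial.eval_eq_sum_range, Finset.mul_sum]
    rw [integral_finsetSum]
    · refine Finset.sum_eq_zero fun i _ => ?_
      have := hpow i 0
      simp only [Nat.cast_zero, zero_mul, Real.cos_zero, mul_one] at this
      simp_rw [mul_left_comm (f _)]
      rw [integral_const_mul, this, mul_zero]
    · intro i _
      have hc : Continuous fun x => p.coeff i * Real.cos (θ x) ^ i := by fun_prop
      exact hint _ hc (hbd _ hc)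
  have hcont : ∀ g : ℝ → ℝ, Continuous g → ∫ x in Ioo a b, f x * g x = 0 := fun g hg => by
    -- `F` is `g` in the variable `cos θ`.
    set F : ℝ → ℝ := fun t => g (a + (b - a) / Real.pi * Real.arccos t) with hF
    have hFc : Continuous F := by
      have := Real.continuous_arccos
      fun_prop
    have hFθ : ∀ x ∈ Ioo a b, F (Real.cos (θ x)) = g x := fun x hx => by
      have h1 : 0 ≤ θ x := div_nonneg (mul_nonneg Real.pi_pos.le (sub_nonneg.2 hx.1.le)) hL.le
      have h2 : θ x ≤ Real.pi := by
        rw [hθ]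
        refine (div_le_iff₀ hL).2 (mul_le_mul_of_nonneg_left ?_ Real.pi_pos.le)
        linarith [hx.2]
      rw [hF]
      simp only
      rw [Real.arccos_cos h1 h2, hθ]
      congr 1
      field_simp
      ring
    set I := ∫ x in Ioo a b, |f x|
    have hI : 0 ≤ I := integral_nonneg fun _ => abs_nonneg _
    refine abs_eq_zero.1 (le_antisymm (le_of_forall_pos_le_add fun ε hε => ?_) (abs_nonneg _))
    -- The `+ 1` keeps the tolerance meaningful when `∫ |f| = 0`.
    obtain ⟨p, hp⟩ := exists_polynomial_near_of_continuousOn (-1) 1 F hFc.continuousOn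
      (ε / (I + 1)) (by positivity)
    have hpc : Continuous fun x => p.eval (Real.cos (θ x)) := by fun_prop
    have e : ∫ x in Ioo a b, f x * g x = ∫ x in Ioo a b, f x * (g x - p.eval (Real.cos (θ x))) := by
      simp_rw [mul_sub]
      rw [integral_sub (hint g hg (hbd g hg)) (hint _ hpc (hbd _ hpc)), hpoly, sub_zero]
    rw [e, zero_add]
    calc |∫ x in Ioo a b, f x * (g x - p.eval (Real.cos (θ x)))|
        ≤ ∫ x in Ioo a b, |f x| * (ε / (I + 1)) := by
          rw [← Real.norm_eq_abs]
          refine norm_integral_le_of_norm_le (hf.norm.mul_const _) ?_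
          refine (ae_restrict_iff' measurableSet_Ioo).2 (.of_forall fun x hx => ?_)
          rw [norm_mul]
          refine mul_le_mul_of_nonneg_left ?_ (norm_nonneg _)
          rw [← hFθ x hx, Real.norm_eq_abs, abs_sub_comm]
          exact (hp _ ⟨Real.neg_one_le_cos _, Real.cos_le_one _⟩).le
      _ = I * (ε / (I + 1)) := integral_mul_const _ _
      _ ≤ ε := by
          rw [mul_div_assoc', div_le_iff₀ (by positivity)]
          nlinarith
  have := isOpen_Ioo.ae_eq_zero_of_integral_contDiff_smul_eq_zero (U := Ioo a b) (f := f)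
    (μ := volume) hf.locallyIntegrableOn fun g hg _ hsupp => by
      have h1 : ∫ x, g x • f x = ∫ x in Ioo a b, g x • f x := by
        refine (setIntegral_eq_integral_of_forall_compl_eq_zero (f := fun x => g x • f x)
          fun x hx => ?_).symm
        have : g x = 0 := image_eq_zero_of_notMem_tsupport fun h => hx (hsupp h)
        rw [this, zero_smul]
      rw [h1, ← hcont g hg.continuous]
      simp [mul_comm]
  exact (ae_restrict_iff' measurableSet_Ioo).2 this

/-! ### The sawtooth weight -/

/-- The sawtooth weight `x - a` to the left and `x - b` to the right of `x₀`. -/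
noncomputable def sawtooth (a b x₀ x : ℝ) : ℝ := if x < x₀ then x - a else x - b

theorem measurable_sawtooth (a b x₀ : ℝ) : Measurable (sawtooth a b x₀) :=
  Measurable.ite measurableSet_Iio (measurable_id.sub_const a) (measurable_id.sub_const b)

theorem abs_sawtooth_le {a b x₀ x : ℝ} (hx : x ∈ Icc a b) : |sawtooth a b x₀ x| ≤ b - a := by
  unfold sawtooth
  split_ifs
  · rw [abs_of_nonneg (by linarith [hx.1])]; linarith [hx.2]
  · rw [abs_of_nonpos (by linarith [hx.2])]; linarith [hx.1]

theorem intervalIntegrable_sawtooth_mul {a b x₀ : ℝ} (hab : a ≤ b) {f : ℝ → ℝ}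
    (hf : IntervalIntegrable f volume a b) :
    IntervalIntegrable (fun x => sawtooth a b x₀ x * f x) volume a b := by
  rw [intervalIntegrable_iff_integrableOn_Icc_of_le hab] at hf ⊢
  refine Integrable.bdd_mul (c := b - a) hf (measurable_sawtooth a b x₀).aestronglyMeasurable ?_
  exact (ae_restrict_iff' measurableSet_Icc).2 (.of_forall fun x hx => abs_sawtooth_le hx)

/-- Integration by parts against the sawtooth weight. -/
theorem integral_sawtooth_mul_deriv {a b x₀ : ℝ} (hx₀ : x₀ ∈ Icc a b) {F F' : ℝ → ℝ}
    (hF : ∀ x, HasDerivAt F (F' x) x) (hF' : Continuous F') :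
    ∫ x in a..b, sawtooth a b x₀ x * F' x = (b - a) * F x₀ - ∫ x in a..b, F x := by
  have hFc : Continuous F := continuous_iff_continuousAt.2 fun x => (hF x).continuousAt
  have hI := intervalIntegrable_sawtooth_mul (x₀ := x₀) (hx₀.1.trans hx₀.2)
    (hF'.intervalIntegrable a b)
  have h1 : x₀ ∈ uIcc a b := by rwa [uIcc_of_le (hx₀.1.trans hx₀.2)]
  have parts : ∀ c p q, ∫ x in p..q, (x - c) * F' x =
      (q - c) * F q - (p - c) * F p - ∫ x in p..q, F x := fun c p q => by
    rw [intervalIntegral.integral_mul_deriv_eq_deriv_mul (u := fun x => x - c) (u' := fun _ => 1)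
      (fun x _ => (hasDerivAt_id x).sub_const c) (fun x _ => hF x)
      (by simp) (hF'.intervalIntegrable _ _)]
    simp
  rw [← intervalIntegral.integral_add_adjacent_intervals
      (hI.mono_set (uIcc_subset_uIcc_left h1)) (hI.mono_set (uIcc_subset_uIcc_right h1)),
    ← intervalIntegral.integral_add_adjacent_intervals
      (hFc.intervalIntegrable a x₀) (hFc.intervalIntegrable x₀ b)]
  -- At `x₀` itself the sawtooth takes its right-hand value, so the comparison is made on the open
  -- interval.
  have e1 : ∫ x in a..x₀, sawtooth a b x₀ x * F' x = ∫ x in a..x₀, (x - a) * F' x := by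
    rw [intervalIntegral.integral_of_le hx₀.1, intervalIntegral.integral_of_le hx₀.1,
      integral_Ioc_eq_integral_Ioo, integral_Ioc_eq_integral_Ioo]
    refine setIntegral_congr_fun measurableSet_Ioo fun x hx => ?_
    simp [sawtooth, hx.2]
  have e2 : ∫ x in x₀..b, sawtooth a b x₀ x * F' x = ∫ x in x₀..b, (x - b) * F' x := by
    refine intervalIntegral.integral_congr fun x hx => ?_
    rw [uIcc_of_le hx₀.2] at hx
    simp [sawtooth, not_lt.2 hx.1]
  rw [e1, e2, parts, parts]
  ring

/-! ### The resolvent equation with nonnegative data -/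

section Resolvent

variable {a b r : ℝ} {u w w' : ℝ → ℝ}

/-- A solution of `r²w - w'' = r²u` with Neumann boundary values and `u ≥ 0` satisfies
`|w'| ≤ r w`. -/
theorem sq_deriv_le_of_resolvent (hab : a < b) (hr : 0 < r)
    (hw : ∀ x, HasDerivAt w (w' x) x) (hw' : ∀ x, HasDerivAt w' (r ^ 2 * (w x - u x)) x)
    (ha : w' a = 0) (hb : w' b = 0) (hu : ∀ x ∈ Icc a b, 0 ≤ u x) {x : ℝ} (hx : x ∈ Icc a b) :
    w' x ^ 2 ≤ r ^ 2 * w x ^ 2 := by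
  have hexp : ∀ c x : ℝ, HasDerivAt (fun y => Real.exp (c * y)) (c * Real.exp (c * x)) x :=
    fun c x => by
      have := ((hasDerivAt_id x).const_mul c).exp
      simpa [mul_comm] using this
  -- The operator `r² - ∂²` factors as `(r + ∂)(r - ∂)` and as `(r - ∂)(r + ∂)`. With the
  -- integrating factors `e^{±rx}`, `u ≥ 0` makes both first-order quantities monotone, so their
  -- signs propagate from one endpoint.
  have hn : ∀ x, HasDerivAt (fun y => Real.exp (r * y) * (r * w y - w' y))
      (Real.exp (r * x) * (r ^ 2 * u x)) x := fun x => by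
    refine ((hexp r x).mul (((hw x).const_mul r).sub (hw' x))).congr_deriv ?_
    simp only [Pi.sub_apply]
    ring
  have hp : ∀ x, HasDerivAt (fun y => Real.exp (-r * y) * (r * w y + w' y))
      (-(Real.exp (-r * x) * (r ^ 2 * u x))) x := fun x => by
    refine ((hexp (-r) x).mul (((hw x).const_mul r).add (hw' x))).congr_deriv ?_
    simp only [Pi.add_apply]
    ring
  have hmono : MonotoneOn (fun y => Real.exp (r * y) * (r * w y - w' y)) (Icc a b) := by
    refine monotoneOn_of_deriv_nonneg (convex_Icc a b)
      (fun x _ => (hn x).continuousAt.continuousWithinAt)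
      (fun x _ => (hn x).differentiableAt.differentiableWithinAt) fun x hx => ?_
    rw [(hn x).deriv]
    have := hu x (interior_subset hx)
    positivity
  have hanti : AntitoneOn (fun y => Real.exp (-r * y) * (r * w y + w' y)) (Icc a b) := by
    refine antitoneOn_of_deriv_nonpos (convex_Icc a b)
      (fun x _ => (hp x).continuousAt.continuousWithinAt)
      (fun x _ => (hp x).differentiableAt.differentiableWithinAt) fun x hx => ?_
    rw [(hp x).deriv]
    have := hu x (interior_subset hx)
    have : 0 ≤ Real.exp (-r * x) * (r ^ 2 * u x) := by positivity
    linarith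
  have hma : a ∈ Icc a b := left_mem_Icc.2 hab.le
  have hmb : b ∈ Icc a b := right_mem_Icc.2 hab.le
  have h1 := hmono hma hmb hab.le
  have h2 := hanti hma hmb hab.le
  simp only [ha, hb, sub_zero, add_zero] at h1 h2
  have hea : Real.exp (-r * a) * Real.exp (r * a) = 1 := by rw [← Real.exp_add]; simp
  have heb : Real.exp (-r * b) * Real.exp (r * b) = 1 := by rw [← Real.exp_add]; simp
  have hlt : Real.exp (r * a) < Real.exp (r * b) := Real.exp_lt_exp.2 (by nlinarith)
  have hlt' : Real.exp (-r * b) < Real.exp (-r * a) := Real.exp_lt_exp.2 (by nlinarith)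
  -- Together the endpoint inequalities give `e^{-r(b-a)} w b ≤ w a ≤ e^{r(b-a)} w b`, impossible
  -- for `w b < 0`.
  have hwb : 0 ≤ w b := by
    by_contra hneg
    push Not at hneg
    have k1 := mul_le_mul_of_nonneg_left h2 (Real.exp_pos (r * a)).le
    have k2 := mul_le_mul_of_nonneg_left h1 (Real.exp_pos (-r * a)).le
    have e1 : Real.exp (-r * a) * (Real.exp (r * a) * (r * w a)) = r * w a := by
      rw [← mul_assoc, hea, one_mul]
    have e2 : Real.exp (r * a) * (Real.exp (-r * a) * (r * w a)) = r * w a := by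
      rw [← mul_assoc, mul_comm (Real.exp (r * a)), hea, one_mul]
    rw [e1] at k2
    rw [e2] at k1
    have hq : Real.exp (r * a) * Real.exp (-r * b) < 1 := by
      rw [← heb, mul_comm (Real.exp (-r * b))]
      exact mul_lt_mul_of_pos_right hlt (Real.exp_pos _)
    have hq' : 1 < Real.exp (-r * a) * Real.exp (r * b) := by
      rw [← heb]
      exact mul_lt_mul_of_pos_right hlt' (Real.exp_pos _)
    have hrw : r * w b < 0 := mul_neg_of_pos_of_neg hr hneg
    rw [← mul_assoc] at k1 k2
    nlinarith
  have hwa : 0 ≤ w a := by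
    have : 0 ≤ Real.exp (-r * a) * (r * w a) := le_trans (by positivity) h2
    have := nonneg_of_mul_nonneg_right this (Real.exp_pos _)
    exact nonneg_of_mul_nonneg_right this hr
  have n0 : 0 ≤ r * w x - w' x := by
    have h := hmono hma hx hx.1
    simp only [ha, sub_zero] at h
    exact nonneg_of_mul_nonneg_right (le_trans (by positivity) h) (Real.exp_pos _)
  have p0 : 0 ≤ r * w x + w' x := by
    have h := hanti hx hmb hx.2
    simp only [hb, add_zero] at h
    exact nonneg_of_mul_nonneg_right (le_trans (by positivity) h) (Real.exp_pos _)
  nlinarith [mul_nonneg n0 p0]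

/-- The quantity equals `(b - a) F(x₀) + ∫ w'²/r²` with `F = (w² - w'²/r²)/2`, and testing the
equation with `w` gives `∫ w'²/r² = ∫ u w - ∫ w²`. The lower bound is the virial inequality for the
resolvent; the upper bound serves only to identify the limit `r → ∞`. -/
theorem integral_sawtooth_resolvent_mem_Icc (hab : a < b) (hr : 0 < r) (huc : Continuous u)
    (hw : ∀ x, HasDerivAt w (w' x) x) (hw' : ∀ x, HasDerivAt w' (r ^ 2 * (w x - u x)) x)
    (ha : w' a = 0) (hb : w' b = 0) (hu : ∀ x ∈ Icc a b, 0 ≤ u x) {x₀ : ℝ}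
    (hx₀ : x₀ ∈ Icc a b) :
    (∫ x in a..b, sawtooth a b x₀ x * (u x * w' x)) + 1 / 2 * ∫ x in a..b, u x * w x ∈
      Icc 0 ((b - a) / 2 * w x₀ ^ 2 + ((∫ x in a..b, u x * w x) - ∫ x in a..b, w x ^ 2)) := by
  have hwc : Continuous w := continuous_iff_continuousAt.2 fun x => (hw x).continuousAt
  have hwc' : Continuous w' := continuous_iff_continuousAt.2 fun x => (hw' x).continuousAt
  have hF : ∀ x, HasDerivAt (fun y => 1 / 2 * (w y ^ 2 - w' y ^ 2 / r ^ 2)) (u x * w' x) x :=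
    fun x => by
      refine ((((hw x).pow 2).sub (((hw' x).pow 2).div_const (r ^ 2))).const_mul
        (1 / 2 : ℝ)).congr_deriv ?_
      field_simp
      simp
      ring
  rw [integral_sawtooth_mul_deriv hx₀ hF (huc.mul hwc')]
  have hG : ∀ x, HasDerivAt (fun y => w y * w' y / r ^ 2)
      (w' x ^ 2 / r ^ 2 + w x ^ 2 - u x * w x) x := fun x => by
    refine (((hw x).mul (hw' x)).div_const (r ^ 2)).congr_deriv ?_
    field_simp
    ring
  have hGI : ∫ x in a..b, (w' x ^ 2 / r ^ 2 + w x ^ 2 - u x * w x) = 0 := by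
    rw [intervalIntegral.integral_eq_sub_of_hasDerivAt (fun x _ => hG x)
      (Continuous.intervalIntegrable (by fun_prop) _ _), ha, hb]
    simp
  have i1 : IntervalIntegrable (fun x => w' x ^ 2 / r ^ 2) volume a b :=
    Continuous.intervalIntegrable (by fun_prop) _ _
  have i2 : IntervalIntegrable (fun x => w x ^ 2) volume a b :=
    Continuous.intervalIntegrable (by fun_prop) _ _
  have i3 : IntervalIntegrable (fun x => u x * w x) volume a b :=
    Continuous.intervalIntegrable (by fun_prop) _ _
  rw [intervalIntegral.integral_sub (i1.add i2) i3, intervalIntegral.integral_add i1 i2] at hGI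
  rw [intervalIntegral.integral_const_mul, intervalIntegral.integral_sub i2 i1]
  have hpos : 0 ≤ ∫ x in a..b, w' x ^ 2 / r ^ 2 :=
    intervalIntegral.integral_nonneg hab.le fun x _ => by positivity
  have hF0 : 0 ≤ w x₀ ^ 2 - w' x₀ ^ 2 / r ^ 2 := by
    have := sq_deriv_le_of_resolvent hab hr hw hw' ha hb hu hx₀
    rw [sub_nonneg, div_le_iff₀ (by positivity)]
    linarith
  have h1 := mul_nonneg (sub_pos.2 hab).le hF0
  have h2 := mul_nonneg (sub_pos.2 hab).le (show 0 ≤ w' x₀ ^ 2 / r ^ 2 by positivity)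
  constructor <;> linarith

end Resolvent

/-! ### Fractional powers as mixtures of resolvents -/

/-- If `∑ λ_k/(λ_k + μ) d_k ≥ 0` for all `μ > 0` then `∑ λ_k^s d_k ≥ 0`. -/
theorem tsum_rpow_mul_nonneg {s : ℝ} (hs : s ∈ Ioo (0 : ℝ) 1) {l d : ℕ → ℝ} (hl : ∀ k, 0 ≤ l k)
    (hsum : Summable fun k => l k ^ s * |d k|)
    (h : ∀ t, 0 < t → 0 ≤ ∑' k, l k / (t + l k) * d k) :
    0 ≤ ∑' k, l k ^ s * d k := by
  -- The kernel is `t^{s-1} λ/(t+λ)`, nonnegative, so absolute summability against `λ^s` justifies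
  -- exchanging sum and integral.
  obtain ⟨μ, hμ⟩ := Real.exists_measure_rpow_eq_integral_rpowIntegrand₀₁ hs
  have hint : ∀ k (c : ℝ), ∫ t in Ioi 0, Real.rpowIntegrand₀₁ s t (l k) * c ∂μ = l k ^ s * c :=
    fun k c => by rw [integral_mul_const, ← (hμ _ (hl k)).2]
  have key := hasSum_integral_of_summable_integral_norm (μ := μ.restrict (Ioi 0))
    (F := fun k t => Real.rpowIntegrand₀₁ s t (l k) * d k)
    (fun k => (hμ _ (hl k)).1.mul_const _) (by
      refine hsum.congr fun k => ?_
      rw [← hint k]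
      refine (setIntegral_congr_fun measurableSet_Ioi fun t ht => ?_).symm
      simp only [norm_mul, Real.norm_eq_abs]
      rw [abs_of_nonneg (Real.rpowIntegrand₀₁_nonneg hs.1 (le_of_lt ht) (hl k))])
  simp_rw [hint] at key
  rw [key.tsum_eq]
  refine setIntegral_nonneg measurableSet_Ioi fun t ht => ?_
  have e : ∀ k, Real.rpowIntegrand₀₁ s t (l k) * d k = t ^ (s - 1) * (l k / (t + l k) * d k) :=
    fun k => by
      rw [Real.rpowIntegrand₀₁_eq_pow_div hs (le_of_lt ht) (hl k)]
      ring
  simp_rw [e, tsum_mul_left]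
  exact mul_nonneg (Real.rpow_nonneg (le_of_lt ht) _) (h t ht)

/-! ### Cosine and sine series -/

/-- The series `∑ e_k φ_k` in the Neumann eigenfunctions. -/
noncomputable def cosineSeries (a b : ℝ) (e : ℕ → ℝ) (x : ℝ) : ℝ :=
  ∑' k, e k * neumannEigenfunction a b k x

/-- The series `∑ e_k s_k` in the Dirichlet eigenfunctions. -/
noncomputable def sineSeries (a b : ℝ) (e : ℕ → ℝ) (x : ℝ) : ℝ :=
  ∑' k, e k * dirichletEigenfunction a b k x

section Series

variable {a b : ℝ} {e : ℕ → ℝ}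

theorem abs_mul_neumannEigenfunction_le (hab : a < b) (e : ℕ → ℝ) (k : ℕ) (x : ℝ) :
    ‖e k * neumannEigenfunction a b k x‖ ≤ |e k| * Real.sqrt (2 / (b - a)) := by
  rw [norm_mul]
  exact mul_le_mul_of_nonneg_left (abs_neumannEigenfunction_le hab k x) (abs_nonneg _)

theorem abs_mul_dirichletEigenfunction_le (a b : ℝ) (e : ℕ → ℝ) (k : ℕ) (x : ℝ) :
    ‖e k * dirichletEigenfunction a b k x‖ ≤ |e k| * Real.sqrt (2 / (b - a)) := by
  rw [norm_mul]
  exact mul_le_mul_of_nonneg_left (abs_dirichletEigenfunction_le a b k x) (abs_nonneg _)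

theorem summable_mul_neumannEigenfunction (hab : a < b) (he : Summable fun k => |e k|) (x : ℝ) :
    Summable fun k => e k * neumannEigenfunction a b k x :=
  (he.mul_right _).of_norm_bounded fun k => abs_mul_neumannEigenfunction_le hab e k x

theorem continuous_cosineSeries (hab : a < b) (he : Summable fun k => |e k|) :
    Continuous (cosineSeries a b e) :=
  continuous_tsum (fun k => (continuous_neumannEigenfunction a b k).const_mul _)
    (he.mul_right _) fun k x => abs_mul_neumannEigenfunction_le hab e k x

theorem hasDerivAt_cosineSeries (hab : a < b) (he : Summable fun k => |e k|)
    (he' : Summable fun k => |neumannFreq a b k * e k|) (x : ℝ) :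
    HasDerivAt (cosineSeries a b e) (sineSeries a b (fun k => -(neumannFreq a b k * e k)) x) x := by
  have h := hasDerivAt_tsum (he'.mul_right (Real.sqrt (2 / (b - a))))
    (g := fun k x => e k * neumannEigenfunction a b k x)
    (fun k y => (hasDerivAt_neumannEigenfunction a b k y).const_mul (e k)) (fun k y => ?_)
    (summable_mul_neumannEigenfunction hab he 0) x
  · refine h.congr_deriv (tsum_congr fun k => ?_)
    ring
  · have := abs_mul_dirichletEigenfunction_le a b (fun k => neumannFreq a b k * e k) k y
    refine le_of_eq_of_le ?_ this
    simp only [norm_mul, norm_neg]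
    ring

theorem hasDerivAt_sineSeries (hab : a < b) (he : Summable fun k => |e k|)
    (he' : Summable fun k => |neumannFreq a b k * e k|) (x : ℝ) :
    HasDerivAt (sineSeries a b e) (cosineSeries a b (fun k => neumannFreq a b k * e k) x) x := by
  have h := hasDerivAt_tsum (he'.mul_right (Real.sqrt (2 / (b - a))))
    (g := fun k x => e k * dirichletEigenfunction a b k x) (y₀ := 0)
    (fun k y => (hasDerivAt_dirichletEigenfunction a b k y).const_mul (e k)) (fun k y => ?_)
    ((he.mul_right _).of_norm_bounded fun k => abs_mul_dirichletEigenfunction_le a b e k 0) x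
  · refine h.congr_deriv (tsum_congr fun k => ?_)
    ring
  · have := abs_mul_neumannEigenfunction_le hab (fun k => neumannFreq a b k * e k) k y
    refine le_of_eq_of_le ?_ this
    simp only [norm_mul]
    ring

theorem hasSum_integral_mul_series {f : ℝ → ℝ} (hab : a ≤ b)
    (hf : IntervalIntegrable f volume a b) (he : Summable fun k => |e k|) {g : ℕ → ℝ → ℝ}
    (hg : ∀ k, Continuous (g k)) {M : ℝ} (hM : ∀ k x, |g k x| ≤ M) :
    HasSum (fun k => e k * ∫ x in a..b, f x * g k x) (∫ x in a..b, f x * ∑' k, e k * g k x) := by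
  rw [intervalIntegrable_iff_integrableOn_Ioc_of_le hab] at hf
  simp_rw [intervalIntegral.integral_of_le hab, ← tsum_mul_left, ← integral_const_mul]
  have hi : ∀ k, Integrable (fun x => f x * (e k * g k x)) (volume.restrict (Ioc a b)) := fun k =>
    hf.mul_bdd (c := |e k| * M) ((hg k).const_mul _).aestronglyMeasurable (.of_forall fun x => by
      rw [norm_mul]
      exact mul_le_mul_of_nonneg_left (hM k x) (abs_nonneg _))
  simp_rw [mul_left_comm (e _)]
  refine hasSum_integral_of_summable_integral_norm hi ?_
  refine Summable.of_nonneg_of_le (fun k => integral_nonneg fun x => norm_nonneg _) (fun k => ?_)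
    (he.mul_right (M * ∫ x in Ioc a b, |f x|))
  calc ∫ x in Ioc a b, ‖f x * (e k * g k x)‖ ≤ ∫ x in Ioc a b, |f x| * (|e k| * M) := by
        refine integral_mono (hi k).norm (hf.norm.mul_const _) fun x => ?_
        simp only [norm_mul]
        exact mul_le_mul_of_nonneg_left (mul_le_mul_of_nonneg_left (hM k x) (abs_nonneg _))
          (abs_nonneg _)
    _ = |e k| * (M * ∫ x in Ioc a b, |f x|) := by rw [integral_mul_const]; ring

theorem hasSum_integral_mul_cosineSeries {f : ℝ → ℝ} (hab : a < b)
    (hf : IntervalIntegrable f volume a b) (he : Summable fun k => |e k|) :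
    HasSum (fun k => e k * ∫ x in a..b, f x * neumannEigenfunction a b k x)
      (∫ x in a..b, f x * cosineSeries a b e x) :=
  hasSum_integral_mul_series hab.le hf he (continuous_neumannEigenfunction a b)
    fun k x => abs_neumannEigenfunction_le hab k x

theorem hasSum_integral_mul_sineSeries {f : ℝ → ℝ} (hab : a < b)
    (hf : IntervalIntegrable f volume a b) (he : Summable fun k => |e k|) :
    HasSum (fun k => e k * ∫ x in a..b, f x * dirichletEigenfunction a b k x)
      (∫ x in a..b, f x * sineSeries a b e x) :=
  hasSum_integral_mul_series hab.le hf he (continuous_dirichletEigenfunction a b)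
    (abs_dirichletEigenfunction_le a b)

theorem integral_cosineSeries_mul_neumannEigenfunction (hab : a < b)
    (he : Summable fun k => |e k|) (j : ℕ) :
    ∫ x in a..b, cosineSeries a b e x * neumannEigenfunction a b j x = e j := by
  have h := hasSum_integral_mul_cosineSeries hab
    ((continuous_neumannEigenfunction a b j).intervalIntegrable a b) he
  simp_rw [integral_neumannEigenfunction_mul hab] at h
  simp_rw [mul_comm (cosineSeries a b e _)]
  refine h.unique ?_
  convert hasSum_ite_eq j (e j) using 2 with k
  by_cases hk : k = j
  · simp [hk]
  · simp [hk, Ne.symm hk]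

theorem hasSum_integral_cosineSeries_mul (hab : a < b) {c : ℕ → ℝ} (hc : Summable fun k => |c k|)
    (he : Summable fun k => |e k|) :
    HasSum (fun k => e k * c k) (∫ x in a..b, cosineSeries a b c x * cosineSeries a b e x) := by
  have h := hasSum_integral_mul_cosineSeries hab
    ((continuous_cosineSeries hab hc).intervalIntegrable a b) he
  simpa only [integral_cosineSeries_mul_neumannEigenfunction hab hc] using h

end Series

/-! ### The resolvent of a nonnegative series -/

section Virial

variable {a b : ℝ} {c : ℕ → ℝ}

/-- The sine coefficient `∫ ψ u s_k` of the product of `u` with the sawtooth weight `ψ`. -/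
noncomputable def sawtoothCoeff (a b x₀ : ℝ) (u : ℝ → ℝ) (k : ℕ) : ℝ :=
  ∫ x in a..b, sawtooth a b x₀ x * u x * dirichletEigenfunction a b k x

/-- Coefficient form of `integral_sawtooth_resolvent_mem_Icc`: multiplying `c_k` by `t/(t+λ_k)`
gives the coefficients of the resolvent `w`, and the left side is `∫ ψ u w' + 1/2 ∫ u w`. -/
theorem tsum_resolvent_mem_Icc (hab : a < b) (hc : Summable fun k => |c k|)
    (hu : ∀ x ∈ Icc a b, 0 ≤ cosineSeries a b c x) {x₀ : ℝ} (hx₀ : x₀ ∈ Icc a b)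
    {t : ℝ} (ht : 0 < t) :
    -∑' k, t / (t + neumannEigenvalue a b k) *
        (neumannFreq a b k * c k * sawtoothCoeff a b x₀ (cosineSeries a b c) k - c k ^ 2 / 2) ∈
      Icc 0 ((b - a) / 2 * (cosineSeries a b
          (fun k => t / (t + neumannEigenvalue a b k) * c k) x₀) ^ 2 +
        ((∑' k, t / (t + neumannEigenvalue a b k) * c k ^ 2) -
          ∑' k, (t / (t + neumannEigenvalue a b k) * c k) ^ 2)) := by
  set r := Real.sqrt t
  have hr : 0 < r := Real.sqrt_pos.2 ht
  have hrt : r ^ 2 = t := Real.sq_sqrt ht.le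
  set u := cosineSeries a b c with hudef
  set e : ℕ → ℝ := fun k => t / (t + neumannEigenvalue a b k) * c k with hedef
  have hl := neumannEigenvalue_nonneg a b
  have hρ0 : ∀ k, 0 ≤ t / (t + neumannEigenvalue a b k) := fun k =>
    div_nonneg ht.le (add_nonneg ht.le (hl k))
  have he : Summable fun k => |e k| := by
    refine hc.of_nonneg_of_le (fun k => abs_nonneg _) fun k => ?_
    rw [abs_mul, abs_of_nonneg (hρ0 k)]
    exact mul_le_of_le_one_left (abs_nonneg _)
      (div_le_one_of_le₀ (by linarith [hl k]) (add_nonneg ht.le (hl k)))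
  have he' : Summable fun k => |neumannFreq a b k * e k| := by
    refine (hc.mul_left r).of_nonneg_of_le (fun k => abs_nonneg _) fun k => ?_
    rw [hedef, ← mul_assoc, abs_mul, abs_of_nonneg (mul_nonneg (neumannFreq_nonneg hab k) (hρ0 k))]
    refine mul_le_mul_of_nonneg_right ?_ (abs_nonneg _)
    have h0 := neumannFreq_nonneg hab k
    rw [mul_div_assoc', div_le_iff₀ (add_pos_of_pos_of_nonneg ht (hl k)), neumannEigenvalue_eq,
      ← hrt]
    nlinarith [mul_nonneg hr.le (sq_nonneg (neumannFreq a b k - r)), mul_pos hr hr,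
      mul_nonneg hr.le (sq_nonneg (neumannFreq a b k)), pow_pos hr 3]
  -- The resolvent equation `w'' = t(w - u)`, coefficient by coefficient. It also makes the
  -- coefficients of `w''` absolutely summable, although `∑ λ_k |c_k|` may diverge.
  have hlam : ∀ k, neumannFreq a b k * -(neumannFreq a b k * e k) = t * (e k - c k) := fun k => by
    have : t + neumannEigenvalue a b k ≠ 0 := (add_pos_of_pos_of_nonneg ht (hl k)).ne'
    have h2 : neumannFreq a b k * -(neumannFreq a b k * e k) = -(neumannEigenvalue a b k * e k) := by
      rw [neumannEigenvalue_eq]; ring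
    rw [h2, hedef]
    field_simp
    ring
  have hem : Summable fun k => |-(neumannFreq a b k * e k)| := by simpa only [abs_neg] using he'
  have hem' : Summable fun k => |neumannFreq a b k * -(neumannFreq a b k * e k)| := by
    simp_rw [hlam, abs_mul]
    refine Summable.mul_left _ ((he.add hc).of_nonneg_of_le (fun k => abs_nonneg _) fun k => ?_)
    exact abs_sub _ _
  set w := cosineSeries a b e with hwdef
  set w' := sineSeries a b (fun k => -(neumannFreq a b k * e k)) with hwdef'
  have hw : ∀ x, HasDerivAt w (w' x) x := hasDerivAt_cosineSeries hab he he'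
  have hw' : ∀ x, HasDerivAt w' (r ^ 2 * (w x - u x)) x := fun x => by
    refine (hasDerivAt_sineSeries hab hem hem' x).congr_deriv ?_
    rw [hrt, hwdef, hudef]
    simp only [cosineSeries]
    rw [← (summable_mul_neumannEigenfunction hab he x).tsum_sub
      (summable_mul_neumannEigenfunction hab hc x), ← tsum_mul_left]
    refine tsum_congr fun k => ?_
    rw [hlam]
    ring
  have ha : w' a = 0 := by simp [hwdef', sineSeries, dirichletEigenfunction_left]
  have hb : w' b = 0 := by simp [hwdef', sineSeries, dirichletEigenfunction_right hab]
  have huc : Continuous u := continuous_cosineSeries hab hc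
  have key := integral_sawtooth_resolvent_mem_Icc hab hr huc hw hw' ha hb hu hx₀
  have huw := hasSum_integral_cosineSeries_mul hab hc he
  have hww := hasSum_integral_cosineSeries_mul hab he he
  have huw' := hasSum_integral_mul_sineSeries hab
    (intervalIntegrable_sawtooth_mul (x₀ := x₀) hab.le (huc.intervalIntegrable a b)) hem
  simp_rw [mul_assoc (sawtooth a b x₀ _)] at huw'
  have hd := (huw'.add (huw.mul_left (1 / 2))).neg
  have e1 : ∑' k, t / (t + neumannEigenvalue a b k) *
      (neumannFreq a b k * c k * sawtoothCoeff a b x₀ u k - c k ^ 2 / 2) =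
      -((∫ x in a..b, sawtooth a b x₀ x * (u x * w' x)) + 1 / 2 * ∫ x in a..b, u x * w x) := by
    rw [← hd.tsum_eq]
    refine tsum_congr fun k => ?_
    simp only [sawtoothCoeff, hedef, mul_assoc (sawtooth a b x₀ _)]
    ring
  have e2 : ∑' k, t / (t + neumannEigenvalue a b k) * c k ^ 2 = ∫ x in a..b, u x * w x := by
    rw [← huw.tsum_eq]
    refine tsum_congr fun k => ?_
    simp only [hedef]
    ring
  have e3 : ∑' k, (e k) ^ 2 = ∫ x in a..b, w x ^ 2 := by
    simp_rw [sq]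
    exact hww.tsum_eq
  rw [e1, e2, e3, neg_neg]
  exact key

open Filter Topology in
/-- The identity `-∫ ψ u u' = 1/2 ∫ u²` in Fourier coefficients, when `u` vanishes at the jump. -/
theorem tsum_sawtooth_eq_zero (hab : a < b) (hc : Summable fun k => |c k|)
    (hu : ∀ x ∈ Icc a b, 0 ≤ cosineSeries a b c x) {x₀ : ℝ} (hx₀ : x₀ ∈ Icc a b)
    (hu0 : cosineSeries a b c x₀ = 0)
    (hd : Summable fun k => |neumannFreq a b k * c k *
      sawtoothCoeff a b x₀ (cosineSeries a b c) k - c k ^ 2 / 2|)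
    (hc2 : Summable fun k => c k ^ 2) :
    ∑' k, (neumannFreq a b k * c k * sawtoothCoeff a b x₀ (cosineSeries a b c) k - c k ^ 2 / 2) =
      0 := by
  have hl := neumannEigenvalue_nonneg a b
  have hρ : ∀ k, Tendsto (fun t : ℝ => t / (t + neumannEigenvalue a b k)) atTop (𝓝 1) := fun k => by
    have h1 : Tendsto (fun t : ℝ => 1 - neumannEigenvalue a b k / (t + neumannEigenvalue a b k))
        atTop (𝓝 (1 - 0)) :=
      tendsto_const_nhds.sub (tendsto_const_nhds.div_atTop (tendsto_atTop_add_const_right _ _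
        tendsto_id))
    rw [sub_zero] at h1
    refine h1.congr' ?_
    filter_upwards [eventually_gt_atTop 0] with t ht
    have : t + neumannEigenvalue a b k ≠ 0 := (add_pos_of_pos_of_nonneg ht (hl k)).ne'
    field_simp
    ring
  have hρ1 : ∀ t : ℝ, 0 < t → ∀ k, |t / (t + neumannEigenvalue a b k)| ≤ 1 := fun t ht k => by
    rw [abs_of_nonneg (div_nonneg ht.le (add_nonneg ht.le (hl k)))]
    exact div_le_one_of_le₀ (by linarith [hl k]) (add_nonneg ht.le (hl k))
  have lim : ∀ f : ℕ → ℝ, Summable (fun k => |f k|) → Tendsto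
      (fun t : ℝ => ∑' k, t / (t + neumannEigenvalue a b k) * f k) atTop (𝓝 (∑' k, f k)) :=
    fun f hf => by
      refine tendsto_tsum_of_dominated_convergence hf (fun k => ?_) ?_
      · simpa using (hρ k).mul_const (f k)
      · filter_upwards [eventually_gt_atTop 0] with t ht k
        rw [norm_mul]
        exact mul_le_of_le_one_left (abs_nonneg _) (hρ1 t ht k)
  have lim2 : Tendsto (fun t : ℝ => ∑' k, (t / (t + neumannEigenvalue a b k) * c k) ^ 2) atTop
      (𝓝 (∑' k, c k ^ 2)) := by
    refine tendsto_tsum_of_dominated_convergence hc2 (fun k => ?_) ?_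
    · simpa using ((hρ k).mul_const (c k)).pow 2
    · filter_upwards [eventually_gt_atTop 0] with t ht k
      rw [norm_pow, Real.norm_eq_abs, sq_le_sq, abs_abs, abs_mul]
      exact mul_le_of_le_one_left (abs_nonneg _) (hρ1 t ht k)
  have lim3 : Tendsto (fun t : ℝ => cosineSeries a b
      (fun k => t / (t + neumannEigenvalue a b k) * c k) x₀) atTop (𝓝 0) := by
    have := lim (fun k => c k * neumannEigenfunction a b k x₀)
      (summable_mul_neumannEigenfunction hab hc x₀).abs
    rw [← hu0]
    simpa only [cosineSeries, mul_assoc] using this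
  -- As `t → ∞` the resolvent tends to `u`, so the upper bound tends to `(b - a)/2 · u(x₀)² + ∑ c_k²
  -- - ∑ c_k² = 0`. The squeeze gives the identity without differentiating `u`.
  have hup := ((lim3.pow 2).const_mul ((b - a) / 2)).add
    ((lim _ (hc2.congr fun k => (abs_of_nonneg (sq_nonneg (c k))).symm)).sub lim2)
  rw [sub_self (∑' k, c k ^ 2), add_zero, zero_pow two_ne_zero, mul_zero] at hup
  have hsq := tendsto_of_tendsto_of_tendsto_of_le_of_le' tendsto_const_nhds hup
    (f := fun t : ℝ => -∑' k, t / (t + neumannEigenvalue a b k) *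
        (neumannFreq a b k * c k * sawtoothCoeff a b x₀ (cosineSeries a b c) k - c k ^ 2 / 2))
    (g := fun _ => 0)
    (by filter_upwards [eventually_gt_atTop 0] with t ht
        exact (tsum_resolvent_mem_Icc hab hc hu hx₀ ht).1)
    (by filter_upwards [eventually_gt_atTop 0] with t ht
        exact (tsum_resolvent_mem_Icc hab hc hu hx₀ ht).2)
  have h0 := tendsto_nhds_unique (lim _ hd).neg (by simpa using hsq)
  simpa using h0

/-- The virial inequality `-∫ ψ u ∂ₓ(-Δ)^s u ≥ 1/2 ∫ |(-Δ)^{s/2} u|²` in Fourier coefficients. -/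
theorem tsum_rpow_sawtooth_nonneg (hab : a < b) {s : ℝ} (hs : s ∈ Ioo (0 : ℝ) 1)
    (hc : Summable fun k => |c k|)
    (hu : ∀ x ∈ Icc a b, 0 ≤ cosineSeries a b c x) {x₀ : ℝ} (hx₀ : x₀ ∈ Icc a b)
    (hu0 : cosineSeries a b c x₀ = 0)
    (hd : Summable fun k => |neumannFreq a b k * c k *
      sawtoothCoeff a b x₀ (cosineSeries a b c) k - c k ^ 2 / 2|)
    (hds : Summable fun k => neumannEigenvalue a b k ^ s * |neumannFreq a b k * c k *
      sawtoothCoeff a b x₀ (cosineSeries a b c) k - c k ^ 2 / 2|)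
    (hc2 : Summable fun k => c k ^ 2) :
    0 ≤ ∑' k, neumannEigenvalue a b k ^ s *
      (neumannFreq a b k * c k * sawtoothCoeff a b x₀ (cosineSeries a b c) k - c k ^ 2 / 2) := by
  have hl := neumannEigenvalue_nonneg a b
  refine tsum_rpow_mul_nonneg hs hl hds fun t ht => ?_
  have h0 := tsum_sawtooth_eq_zero hab hc hu hx₀ hu0 hd hc2
  have h1 := (tsum_resolvent_mem_Icc hab hc hu hx₀ ht).1
  set d : ℕ → ℝ := fun k => neumannFreq a b k * c k *
      sawtoothCoeff a b x₀ (cosineSeries a b c) k - c k ^ 2 / 2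
  have hρ : Summable fun k => t / (t + neumannEigenvalue a b k) * d k := by
    refine hd.of_norm_bounded fun k => ?_
    rw [norm_mul, Real.norm_eq_abs, abs_of_nonneg (div_nonneg ht.le (add_nonneg ht.le (hl k)))]
    exact mul_le_of_le_one_left (abs_nonneg _)
      (div_le_one_of_le₀ (by linarith [hl k]) (add_nonneg ht.le (hl k)))
  -- Here `λ/(t+λ) = 1 - t/(t+λ)`: the identity contributes zero and the resolvent enters with the
  -- favourable sign.
  have e : ∑' k, neumannEigenvalue a b k / (t + neumannEigenvalue a b k) * d k =
      (∑' k, d k) - ∑' k, t / (t + neumannEigenvalue a b k) * d k := by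
    rw [← hd.of_abs.tsum_sub hρ]
    refine tsum_congr fun k => ?_
    have : t + neumannEigenvalue a b k ≠ 0 := (add_pos_of_pos_of_nonneg ht (hl k)).ne'
    field_simp
    ring
  rw [e, h0]
  linarith

end Virial

/-! ### Expansions in `L²` -/

theorem Orthonormal.summable_smul {E : Type*} [NormedAddCommGroup E] [InnerProductSpace ℝ E]
    [CompleteSpace E] {e : ℕ → E} (he : Orthonormal ℝ e) {c : ℕ → ℝ}
    (hc : Summable fun k => c k ^ 2) : Summable fun k => c k • e k := by
  have := (he.orthogonalFamily.summable_iff_norm_sq_summable c).2 (by simpa using hc)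
  simpa using this

/-- Parseval for a given sum: pairing with `e k` recovers the coefficient, so completeness of the
family plays no role. -/
theorem Orthonormal.inner_self_eq_tsum {E : Type*} [NormedAddCommGroup E] [InnerProductSpace ℝ E]
    {e : ℕ → E} (he : Orthonormal ℝ e) {c : ℕ → ℝ} {x : E} (hx : HasSum (fun k => c k • e k) x) :
    inner ℝ x x = ∑' k, c k ^ 2 := by
  have hin : ∀ k, inner ℝ (e k) x = c k := fun k => by
    have h := hx.mapL (innerSL ℝ (e k))
    simp only [innerSL_apply_apply, inner_smul_right, orthonormal_iff_ite.1 he, mul_ite, mul_one,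
      mul_zero] at h
    refine h.unique ?_
    have hite : (fun j => if k = j then c j else 0) = fun j => if j = k then c k else 0 :=
      funext fun j => by
        rcases eq_or_ne j k with rfl | hj
        · simp
        · simp [hj, hj.symm]
    rw [hite]
    exact hasSum_ite_eq k (c k)
  have h := hx.mapL (innerSL ℝ x)
  rw [innerSL_apply_apply] at h
  rw [← h.tsum_eq]
  refine tsum_congr fun k => ?_
  rw [innerSL_apply_apply, inner_smul_right, real_inner_comm, hin, sq]

theorem inner_toLp_eq_integral {α : Type*} [MeasurableSpace α] {μ : Measure α} {f : α → ℝ}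
    (hf : MemLp f 2 μ) (G : Lp ℝ 2 μ) : inner ℝ (hf.toLp f) G = ∫ x, f x * G x ∂μ := by
  rw [L2.inner_def]
  refine integral_congr_ae ?_
  filter_upwards [hf.coeFn_toLp] with x hx
  simp [hx, mul_comm]

theorem inner_toLp_toLp_eq_integral {α : Type*} [MeasurableSpace α] {μ : Measure α} {f g : α → ℝ}
    (hf : MemLp f 2 μ) (hg : MemLp g 2 μ) :
    inner ℝ (hf.toLp f) (hg.toLp g) = ∫ x, f x * g x ∂μ := by
  rw [inner_toLp_eq_integral]
  refine integral_congr_ae ?_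
  filter_upwards [hg.coeFn_toLp] with x hx
  rw [hx]

theorem integral_abs_sq_eq_inner {α : Type*} [MeasurableSpace α] {μ : Measure α}
    (G : Lp ℝ 2 μ) : ∫ x, |G x| ^ 2 ∂μ = inner ℝ G G := by
  rw [L2.inner_def]
  refine integral_congr_ae (.of_forall fun x => ?_)
  simp [sq]

theorem memLp_two_of_continuous (a b : ℝ) {f : ℝ → ℝ} (hf : Continuous f) :
    MemLp f 2 (volume.restrict (Ioo a b)) := by
  obtain ⟨C, hC⟩ := isCompact_Icc.exists_bound_of_continuousOn (s := Icc a b) hf.continuousOn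
  exact MemLp.of_bound hf.aestronglyMeasurable C ((ae_restrict_iff' measurableSet_Ioo).2
    (.of_forall fun x hx => hC x (Ioo_subset_Icc_self hx)))

theorem memLp_sawtooth_mul (a b x₀ : ℝ) {f : ℝ → ℝ} (hf : Continuous f) :
    MemLp (fun x => sawtooth a b x₀ x * f x) 2 (volume.restrict (Ioo a b)) := by
  obtain ⟨C, hC⟩ := isCompact_Icc.exists_bound_of_continuousOn (s := Icc a b) hf.continuousOn
  refine MemLp.of_bound ((measurable_sawtooth a b x₀).mul hf.measurable).aestronglyMeasurable
    ((b - a) * C) ((ae_restrict_iff' measurableSet_Ioo).2 (.of_forall fun x hx => ?_))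
  have hx' := Ioo_subset_Icc_self hx
  rw [norm_mul]
  exact mul_le_mul (abs_sawtooth_le hx') (hC x hx') (norm_nonneg _) (by linarith [hx.1, hx.2])

theorem memLp_dirichletEigenfunction (a b : ℝ) (k : ℕ) :
    MemLp (dirichletEigenfunction a b k) 2 (volume.restrict (Ioo a b)) :=
  memLp_two_of_continuous a b (continuous_dirichletEigenfunction a b k)

theorem orthonormal_neumannEigenfunction {a b : ℝ} (hab : a < b) :
    Orthonormal ℝ fun k => (memLp_neumannEigenfunction a b k).toLp (neumannEigenfunction a b k) := by
  rw [orthonormal_iff_ite]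
  intro j k
  rw [inner_toLp_toLp_eq_integral, integral_Ioo_eq_intervalIntegral hab.le,
    integral_neumannEigenfunction_mul hab]

/-- The index is shifted because the sine of index `0` vanishes identically. -/
theorem orthonormal_dirichletEigenfunction {a b : ℝ} (hab : a < b) :
    Orthonormal ℝ fun k => (memLp_dirichletEigenfunction a b (k + 1)).toLp
      (dirichletEigenfunction a b (k + 1)) := by
  rw [orthonormal_iff_ite]
  intro j k
  rw [inner_toLp_toLp_eq_integral, integral_Ioo_eq_intervalIntegral hab.le,
    integral_dirichletEigenfunction_mul hab k.succ_ne_zero]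
  simp

/-- Bessel's inequality for the sine coefficients. -/
theorem summable_sq_integral_mul_dirichletEigenfunction {a b : ℝ} (hab : a < b) {f : ℝ → ℝ}
    (hf : MemLp f 2 (volume.restrict (Ioo a b))) :
    Summable fun k => (∫ x in a..b, f x * dirichletEigenfunction a b k x) ^ 2 := by
  rw [← summable_nat_add_iff 1]
  have := (orthonormal_dirichletEigenfunction hab).inner_products_summable (hf.toLp f)
  refine this.congr fun k => ?_
  rw [real_inner_comm, inner_toLp_toLp_eq_integral, integral_Ioo_eq_intervalIntegral hab.le,
    Real.norm_eq_abs, sq_abs]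

/-- The `L²` sum of a square summable sine series. -/
noncomputable def sineSeriesLp (a b : ℝ) (e : ℕ → ℝ) : Lp ℝ 2 (volume.restrict (Ioo a b)) :=
  ∑' k : ℕ, e (k + 1) • (memLp_dirichletEigenfunction a b (k + 1)).toLp
    (dirichletEigenfunction a b (k + 1))

theorem hasSum_integral_mul_sineSeriesLp {a b : ℝ} (hab : a < b) {e : ℕ → ℝ}
    (he : Summable fun k => e k ^ 2) {f : ℝ → ℝ} (hf : MemLp f 2 (volume.restrict (Ioo a b))) :
    HasSum (fun k => e k * ∫ x in a..b, f x * dirichletEigenfunction a b k x)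
      (∫ x in Ioo a b, f x * sineSeriesLp a b e x) := by
  rw [← hasSum_nat_add_iff' 1]
  have h := ((orthonormal_dirichletEigenfunction hab).summable_smul
    ((summable_nat_add_iff 1).2 he)).hasSum.mapL (innerSL ℝ (hf.toLp f))
  simp only [innerSL_apply_apply, inner_smul_right, inner_toLp_toLp_eq_integral,
    integral_Ioo_eq_intervalIntegral hab.le] at h
  simpa [dirichletEigenfunction_zero, sineSeriesLp, inner_toLp_eq_integral] using h

section FracLaplacian

variable {a b σ : ℝ} {v : ℝ → ℝ}

theorem hasSum_neumannFracLaplacian (hab : a < b)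
    (hv : Summable fun k => (neumannEigenvalue a b k ^ σ * neumannCoeff a b v k) ^ 2) :
    HasSum (fun k : ℕ => (neumannEigenvalue a b k ^ σ * neumannCoeff a b v k) •
      (memLp_neumannEigenfunction a b k).toLp (neumannEigenfunction a b k))
      (neumannFracLaplacian a b σ v) :=
  ((orthonormal_neumannEigenfunction hab).summable_smul hv).hasSum

theorem hasSum_integral_mul_neumannFracLaplacian (hab : a < b)
    (hv : Summable fun k => (neumannEigenvalue a b k ^ σ * neumannCoeff a b v k) ^ 2) {f : ℝ → ℝ}
    (hf : MemLp f 2 (volume.restrict (Ioo a b))) :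
    HasSum (fun k => neumannEigenvalue a b k ^ σ * neumannCoeff a b v k *
        ∫ x in a..b, f x * neumannEigenfunction a b k x)
      (∫ x in Ioo a b, f x * neumannFracLaplacian a b σ v x) := by
  have h := (hasSum_neumannFracLaplacian hab hv).mapL (innerSL ℝ (hf.toLp f))
  rw [innerSL_apply_apply, inner_toLp_eq_integral] at h
  simpa only [innerSL_apply_apply, inner_smul_right, inner_toLp_toLp_eq_integral,
    integral_Ioo_eq_intervalIntegral hab.le (fun x => f x * neumannEigenfunction a b _ x)] using h

theorem integral_sq_neumannFracLaplacian (hab : a < b)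
    (hv : Summable fun k => (neumannEigenvalue a b k ^ σ * neumannCoeff a b v k) ^ 2) :
    ∫ x in Ioo a b, |neumannFracLaplacian a b σ v x| ^ 2 =
      ∑' k, (neumannEigenvalue a b k ^ σ * neumannCoeff a b v k) ^ 2 := by
  rw [integral_abs_sq_eq_inner]
  exact (orthonormal_neumannEigenfunction hab).inner_self_eq_tsum
    (hasSum_neumannFracLaplacian hab hv)

/-- Termwise differentiation of a Neumann expansion. -/
theorem hasWeakDerivOn_neumannFracLaplacian (hab : a < b)
    (hv : Summable fun k => (neumannEigenvalue a b k ^ σ * neumannCoeff a b v k) ^ 2)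
    (hv' : Summable fun k =>
      (-(neumannEigenvalue a b k ^ σ * neumannFreq a b k * neumannCoeff a b v k)) ^ 2) :
    HasWeakDerivOn a b (neumannFracLaplacian a b σ v) (sineSeriesLp a b fun k =>
      -(neumannEigenvalue a b k ^ σ * neumannFreq a b k * neumannCoeff a b v k)) := by
  have hloc : ∀ G : Lp ℝ 2 (volume.restrict (Ioo a b)), LocallyIntegrableOn G (Ioo a b) :=
    fun G => IntegrableOn.locallyIntegrableOn ((Lp.memLp G).integrable (by norm_num))
  refine ⟨hloc _, hloc _, fun φ hφ _ hsupp => ?_⟩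
  have hφ' : Continuous (deriv φ) := hφ.continuous_deriv (by simp)
  have hz : ∀ x, x ∉ Ioo a b → φ x = 0 := fun x hx =>
    image_eq_zero_of_notMem_tsupport fun h => hx (hsupp h)
  have h1 := hasSum_integral_mul_neumannFracLaplacian hab hv (memLp_two_of_continuous a b hφ')
  have h2 := (hasSum_integral_mul_sineSeriesLp hab hv'
    (memLp_two_of_continuous a b hφ.continuous)).neg
  simp_rw [mul_comm _ (deriv φ _), mul_comm _ (φ _)]
  refine h1.unique (h2.congr_fun fun k => ?_)
  have hparts := intervalIntegral.integral_mul_deriv_eq_deriv_mul (a := a) (b := b)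
    (fun x _ => hasDerivAt_neumannEigenfunction a b k x)
    (fun x _ => (hφ.differentiable (by simp)).differentiableAt.hasDerivAt)
    (((continuous_dirichletEigenfunction a b k).const_mul _).neg.intervalIntegrable a b)
    (hφ'.intervalIntegrable a b)
  rw [hz a (by simp), hz b (by simp)] at hparts
  simp only [mul_zero, sub_self, zero_sub, neg_mul, intervalIntegral.integral_neg, neg_neg,
    mul_assoc, intervalIntegral.integral_const_mul] at hparts
  simp_rw [mul_comm (deriv φ _), hparts, mul_comm (φ _)]
  ring

end FracLaplacian

/-! ### Uniqueness of weak derivatives and weighted Cauchy–Schwarz -/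

/-- Transfers the estimate from the explicit sine series to an arbitrary weak derivative. -/
theorem HasWeakDerivOn.ae_eq {a b : ℝ} {g h₁ h₂ : ℝ → ℝ} (H₁ : HasWeakDerivOn a b g h₁)
    (H₂ : HasWeakDerivOn a b g h₂) : h₁ =ᵐ[volume.restrict (Ioo a b)] h₂ := by
  have hint : ∀ h : ℝ → ℝ, LocallyIntegrableOn h (Ioo a b) → ∀ φ : ℝ → ℝ, Continuous φ →
      HasCompactSupport φ → tsupport φ ⊆ Ioo a b → IntegrableOn (fun x => h x * φ x) (Ioo a b) :=
    fun h hh φ hφ hc hs => by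
      have h1 := (hh.integrableOn_compact_subset hs hc).mul_continuousOn hφ.continuousOn hc
      refine h1.of_forall_sdiff_eq_zero measurableSet_Ioo fun x hx => ?_
      rw [image_eq_zero_of_notMem_tsupport hx.2, mul_zero]
  have := isOpen_Ioo.ae_eq_zero_of_integral_contDiff_smul_eq_zero (U := Ioo a b)
    (f := fun x => h₁ x - h₂ x) (μ := volume) (H₁.2.1.sub H₂.2.1) fun φ hφ hc hs => by
      have h1 : ∫ x, φ x • (h₁ x - h₂ x) = ∫ x in Ioo a b, φ x • (h₁ x - h₂ x) := by
        refine (setIntegral_eq_integral_of_forall_compl_eq_zero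
          (f := fun x => φ x • (h₁ x - h₂ x)) fun x hx => ?_).symm
        have : φ x = 0 := image_eq_zero_of_notMem_tsupport fun h => hx (hs h)
        rw [this, zero_smul]
      have h2 : ∀ x, φ x • (h₁ x - h₂ x) = h₁ x * φ x - h₂ x * φ x := fun x => by
        rw [smul_eq_mul]; ring
      rw [h1]
      simp_rw [h2]
      rw [integral_sub (hint _ H₁.2.1 φ hφ.continuous hc hs) (hint _ H₂.2.1 φ hφ.continuous hc hs)]
      linarith [H₁.2.2 φ hφ hc hs, H₂.2.2 φ hφ hc hs]
  filter_upwards [(ae_restrict_iff' measurableSet_Ioo).2 this] with x hx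
  linarith

/-- The Cauchy–Schwarz inequality with a degenerate weight. -/
theorem lintegral_mul_sq_le_weighted {α : Type*} [MeasurableSpace α] {μ : Measure α}
    {v h : α → ℝ} {w : α → ℝ≥0} (hv : AEMeasurable v μ) (hh : AEMeasurable h μ)
    (hw : AEMeasurable w μ) (hA : ∫⁻ x, ENNReal.ofReal (v x ^ 2) / (w x : ℝ≥0∞) ∂μ ≠ ⊤) :
    (∫⁻ x, ENNReal.ofReal |v x * h x| ∂μ) ^ 2 ≤
      (∫⁻ x, ENNReal.ofReal (v x ^ 2) / (w x : ℝ≥0∞) ∂μ) *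
        ∫⁻ x, (w x : ℝ≥0∞) * ENNReal.ofReal (h x ^ 2) ∂μ := by
  have hF : AEMeasurable (fun x => ENNReal.ofReal (v x ^ 2) / (w x : ℝ≥0∞)) μ :=
    (hv.pow_const 2).ennreal_ofReal.div hw.coe_nnreal_ennreal
  have hG : AEMeasurable (fun x => (w x : ℝ≥0∞) * ENNReal.ofReal (h x ^ 2)) μ :=
    hw.coe_nnreal_ennreal.mul (hh.pow_const 2).ennreal_ofReal
  have hsq : ∀ y : ℝ≥0∞, (y ^ (1 / 2 : ℝ)) ^ (2 : ℝ) = y := fun y => by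
    rw [← ENNReal.rpow_mul]; norm_num
  have hH := ENNReal.lintegral_mul_le_Lp_mul_Lq μ Real.HolderConjugate.two_two
    (hF.pow_const (1 / 2 : ℝ)) (hG.pow_const (1 / 2 : ℝ))
  simp only [Pi.mul_apply, hsq] at hH
  have hle : ∫⁻ x, ENNReal.ofReal |v x * h x| ∂μ ≤
      ∫⁻ x, (ENNReal.ofReal (v x ^ 2) / (w x : ℝ≥0∞)) ^ (1 / 2 : ℝ) *
        ((w x : ℝ≥0∞) * ENNReal.ofReal (h x ^ 2)) ^ (1 / 2 : ℝ) ∂μ := by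
    refine lintegral_mono_ae ?_
    filter_upwards [ae_lt_top' hF hA] with x hx
    -- A positive number over `0` is `⊤`, so finiteness of the first integral forces `v = 0` at
    -- almost every zero of `w`.
    rcases eq_or_ne (w x) 0 with h0 | h0
    · have : v x = 0 := by
        by_contra hne
        have hpos : ENNReal.ofReal (v x ^ 2) ≠ 0 := by
          rw [Ne, ENNReal.ofReal_eq_zero, not_le]
          positivity
        simp [h0, ENNReal.div_zero hpos] at hx
      simp [this]
    · have hw0 : (w x : ℝ≥0∞) ≠ 0 := by exact_mod_cast h0
      rw [← ENNReal.mul_rpow_of_nonneg _ _ (by norm_num), ← mul_assoc,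
        ENNReal.div_mul_cancel hw0 ENNReal.coe_ne_top, ← ENNReal.ofReal_mul (sq_nonneg _),
        ENNReal.ofReal_rpow_of_nonneg (by positivity) (by norm_num), ← mul_pow,
        ← Real.sqrt_eq_rpow, Real.sqrt_sq_eq_abs]
  calc (∫⁻ x, ENNReal.ofReal |v x * h x| ∂μ) ^ 2 ≤ _ := pow_le_pow_left' (hle.trans hH) 2
    _ = _ := by
      rw [mul_pow, ← ENNReal.rpow_natCast, ← ENNReal.rpow_natCast]
      push_cast
      rw [hsq, hsq]

/-! ### Summability in `H^{2s+1}_N` -/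

theorem rpow_le_one_add_rpow {x q p : ℝ} (hx : 0 ≤ x) (hq : 0 ≤ q) (hqp : q ≤ p) :
    x ^ q ≤ 1 + x ^ p := by
  rcases le_total x 1 with h | h
  · linarith [Real.rpow_le_one hx h hq, Real.rpow_nonneg hx p]
  · linarith [Real.rpow_le_rpow_of_exponent_le h hqp]

section Summability

variable {a b p : ℝ} {c : ℕ → ℝ}

theorem summable_sq_mul_rpow (hc : Summable fun k => c k ^ 2 * (1 + neumannEigenvalue a b k ^ p))
    {q : ℝ} (hq : 0 ≤ q) (hqp : q ≤ p) :
    Summable fun k => c k ^ 2 * neumannEigenvalue a b k ^ q :=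
  hc.of_nonneg_of_le
    (fun k => mul_nonneg (sq_nonneg _) (Real.rpow_nonneg (neumannEigenvalue_nonneg a b k) _))
    fun k => mul_le_mul_of_nonneg_left
      (rpow_le_one_add_rpow (neumannEigenvalue_nonneg a b k) hq hqp) (sq_nonneg _)

/-- Write `|c_k| = λ_k^{-1/2} · λ_k^{1/2} |c_k|` for `k ≥ 1`: both factors are square summable, the
first like `1/k`. -/
theorem summable_abs_of_sobolev (hab : a < b) (hp : 1 ≤ p)
    (hc : Summable fun k => c k ^ 2 * (1 + neumannEigenvalue a b k ^ p)) :
    Summable fun k => |c k| := by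
  have hL := sub_pos.2 hab
  have hs : Summable fun k : ℕ => ((b - a) / Real.pi) ^ 2 * (1 / ((k + 1 : ℕ) : ℝ) ^ 2) :=
    ((summable_nat_add_iff (f := fun k : ℕ => 1 / (k : ℝ) ^ 2) 1).2
      (Real.summable_one_div_nat_pow.2 one_lt_two)).mul_left _
  have hc' : Summable fun k => c (k + 1) ^ 2 * neumannEigenvalue a b (k + 1) :=
    (summable_nat_add_iff (f := fun k => c k ^ 2 * neumannEigenvalue a b k) 1).2
      ((summable_sq_mul_rpow hc zero_le_one hp).congr fun k => by rw [Real.rpow_one])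
  rw [← summable_nat_add_iff 1]
  refine (hs.add hc').of_nonneg_of_le (fun k => abs_nonneg _) fun k => ?_
  set y := neumannFreq a b (k + 1) with hy
  have hy0 : 0 < y := by
    rw [hy, neumannFreq]
    positivity
  have e : ((b - a) / Real.pi) ^ 2 * (1 / ((k + 1 : ℕ) : ℝ) ^ 2) = y⁻¹ ^ 2 := by
    rw [hy, neumannFreq]
    field_simp
  rw [e, neumannEigenvalue_eq, ← hy]
  have h1 : |c (k + 1)| = y⁻¹ * (|c (k + 1)| * y) := by field_simp
  have h2 : c (k + 1) ^ 2 * y ^ 2 = (|c (k + 1)| * y) ^ 2 := by rw [mul_pow, sq_abs]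
  rw [h1, h2]
  nlinarith [sq_nonneg (y⁻¹ - |c (k + 1)| * y), sq_nonneg (y⁻¹ + |c (k + 1)| * y)]

theorem sq_rpow_mul (a b s x : ℝ) (hs : 0 < s) (k : ℕ) :
    (neumannEigenvalue a b k ^ s * neumannFreq a b k * x) ^ 2 =
      x ^ 2 * neumannEigenvalue a b k ^ (2 * s + 1) := by
  have hl := neumannEigenvalue_nonneg a b k
  rw [Real.rpow_add_one' hl (by linarith), mul_comm 2 s, Real.rpow_mul hl, neumannEigenvalue_eq]
  norm_num
  ring

end Summability

/-! ### The virial inequality -/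

/-- Bessel's inequality makes the sine coefficients of `ψ u` square summable, and the Sobolev
hypothesis does the same for `λ_k^{s+1/2} c_k`. All series then converge absolutely and
`tsum_rpow_sawtooth_nonneg` can be split into its two terms. -/
theorem half_tsum_le_tsum_sawtoothCoeff {a b s : ℝ} (hab : a < b) (hs : s ∈ Ioo (0 : ℝ) 1)
    {c : ℕ → ℝ} (hc : Summable fun k => c k ^ 2 * (1 + neumannEigenvalue a b k ^ (2 * s + 1)))
    (hu : ∀ x ∈ Icc a b, 0 ≤ cosineSeries a b c x) {x₀ : ℝ} (hx₀ : x₀ ∈ Icc a b)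
    (hu0 : cosineSeries a b c x₀ = 0) :
    1 / 2 * ∑' k, neumannEigenvalue a b k ^ s * c k ^ 2 ≤
      ∑' k, neumannEigenvalue a b k ^ s * neumannFreq a b k * c k *
        sawtoothCoeff a b x₀ (cosineSeries a b c) k := by
  obtain ⟨hs0, hs1⟩ := hs
  have hl := neumannEigenvalue_nonneg a b
  have habs := summable_abs_of_sobolev hab (by linarith) hc
  set β := sawtoothCoeff a b x₀ (cosineSeries a b c) with hβdef
  have hβ : Summable fun k => β k ^ 2 :=
    summable_sq_integral_mul_dirichletEigenfunction hab
      (memLp_sawtooth_mul a b x₀ (continuous_cosineSeries hab habs))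
  have hprod : ∀ f : ℕ → ℝ, (Summable fun k => f k ^ 2) → Summable fun k => |f k * β k| :=
    fun f hf => (hf.add hβ).of_nonneg_of_le (fun k => abs_nonneg _) fun k => by
      rw [abs_mul, ← sq_abs (f k), ← sq_abs (β k)]
      nlinarith [sq_nonneg (|f k| - |β k|), sq_nonneg (|f k| + |β k|)]
  have hc2 : Summable fun k => c k ^ 2 := by
    simpa using summable_sq_mul_rpow hc le_rfl (by linarith)
  have h1 : Summable fun k => |neumannFreq a b k * c k * β k| := hprod _ (by
    refine (summable_sq_mul_rpow hc zero_le_one (by linarith)).congr fun k => ?_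
    rw [Real.rpow_one, neumannEigenvalue_eq]
    ring)
  have h2 : Summable fun k => |neumannEigenvalue a b k ^ s * neumannFreq a b k * c k * β k| :=
    hprod _ ((summable_sq_mul_rpow hc (by linarith) le_rfl).congr fun k =>
      (sq_rpow_mul a b s _ hs0 k).symm)
  have h3 : Summable fun k => neumannEigenvalue a b k ^ s * c k ^ 2 :=
    (summable_sq_mul_rpow hc hs0.le (by linarith)).congr fun k => mul_comm _ _
  have hd : Summable fun k => |neumannFreq a b k * c k * β k - c k ^ 2 / 2| :=
    (h1.of_abs.sub (hc2.div_const 2)).abs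
  have hds : Summable fun k =>
      neumannEigenvalue a b k ^ s * (neumannFreq a b k * c k * β k - c k ^ 2 / 2) :=
    (h2.of_abs.sub (h3.div_const 2)).congr fun k => by ring
  have key := tsum_rpow_sawtooth_nonneg hab ⟨hs0, hs1⟩ habs hu hx₀ hu0 hd
    (hds.abs.congr fun k => by rw [abs_mul, abs_of_nonneg (Real.rpow_nonneg (hl k) _)]) hc2
  have e : ∑' k, neumannEigenvalue a b k ^ s * (neumannFreq a b k * c k * β k - c k ^ 2 / 2) =
      (∑' k, neumannEigenvalue a b k ^ s * neumannFreq a b k * c k * β k) -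
        1 / 2 * ∑' k, neumannEigenvalue a b k ^ s * c k ^ 2 := by
    rw [← tsum_mul_left, ← h2.of_abs.tsum_sub (h3.mul_left _)]
    exact tsum_congr fun k => by ring
  rw [e] at key
  linarith

theorem half_tsum_le_integral_abs {a b s : ℝ} (hab : a < b) (hs : s ∈ Ioo (0 : ℝ) 1)
    {c : ℕ → ℝ} (hc : Summable fun k => c k ^ 2 * (1 + neumannEigenvalue a b k ^ (2 * s + 1)))
    (hu : ∀ x ∈ Icc a b, 0 ≤ cosineSeries a b c x) {x₀ : ℝ} (hx₀ : x₀ ∈ Icc a b)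
    (hu0 : cosineSeries a b c x₀ = 0) :
    1 / (2 * (b - a)) * ∑' k, neumannEigenvalue a b k ^ s * c k ^ 2 ≤
      ∫ x in Ioo a b, |cosineSeries a b c x * sineSeriesLp a b
        (fun k => -(neumannEigenvalue a b k ^ s * neumannFreq a b k * c k)) x| := by
  have hL := sub_pos.2 hab
  have hcont := continuous_cosineSeries hab (summable_abs_of_sobolev hab (by linarith [hs.1]) hc)
  have hψ := memLp_sawtooth_mul a b x₀ hcont
  have hu2 := memLp_two_of_continuous a b hcont
  set u := cosineSeries a b c
  have he : Summable fun k =>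
      (-(neumannEigenvalue a b k ^ s * neumannFreq a b k * c k)) ^ 2 :=
    (summable_sq_mul_rpow hc (by linarith [hs.1]) le_rfl).congr fun k => by
      rw [neg_sq, sq_rpow_mul a b s _ hs.1 k]
  have h1 := (hasSum_integral_mul_sineSeriesLp hab he hψ).neg.tsum_eq
  have h2 := half_tsum_le_tsum_sawtoothCoeff hab hs hc hu hx₀ hu0
  simp only [neg_mul, neg_neg] at h1
  set h := sineSeriesLp a b fun k => -(neumannEigenvalue a b k ^ s * neumannFreq a b k * c k)
  have hi : Integrable (fun x => |u x * h x|) (volume.restrict (Ioo a b)) :=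
    (hu2.integrable_mul (Lp.memLp h)).abs
  have h3 : -∫ x in Ioo a b, sawtooth a b x₀ x * u x * h x ≤
      (b - a) * ∫ x in Ioo a b, |u x * h x| := by
    rw [← integral_neg, ← integral_const_mul]
    refine integral_mono_ae (hψ.integrable_mul (Lp.memLp h)).neg (hi.const_mul _)
      ((ae_restrict_iff' measurableSet_Ioo).2 (.of_forall fun x hx => ?_))
    refine (neg_le_abs _).trans ?_
    rw [mul_assoc, abs_mul]
    exact mul_le_mul_of_nonneg_right (abs_sawtooth_le (Ioo_subset_Icc_self hx)) (abs_nonneg _)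
  rw [one_div, inv_mul_le_iff₀ (by positivity)]
  have h4 : 1 / 2 * ∑' k, neumannEigenvalue a b k ^ s * c k ^ 2 ≤
      -∫ x in Ioo a b, sawtooth a b x₀ x * u x * h x := by
    rw [← h1]
    exact h2
  linarith

/-- A function with absolutely summable coefficients is a.e. equal to its cosine series. -/
theorem ae_eq_cosineSeries {a b : ℝ} (hab : a < b) {v : ℝ → ℝ}
    (hv : MemLp v 2 (volume.restrict (Ioo a b)))
    (hc : Summable fun k => |neumannCoeff a b v k|) :
    v =ᵐ[volume.restrict (Ioo a b)] cosineSeries a b (neumannCoeff a b v) := by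
  have hcont := memLp_two_of_continuous a b (continuous_cosineSeries hab hc)
  have h := ae_eq_zero_of_neumannCoeff_eq_zero hab
    (f := fun x => v x - cosineSeries a b (neumannCoeff a b v) x)
    ((hv.sub hcont).integrable (by norm_num)) fun k => by
      have hφ := memLp_neumannEigenfunction a b k
      have e := integral_cosineSeries_mul_neumannEigenfunction hab hc k
      rw [← integral_Ioo_eq_intervalIntegral hab.le] at e
      rw [neumannCoeff]
      simp_rw [sub_mul]
      refine (integral_sub (hv.integrable_mul hφ) (hcont.integrable_mul hφ)).trans ?_
      exact sub_eq_zero.2 e.symm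
  filter_upwards [h] with x hx
  linarith

theorem nonneg_on_Icc_of_ae {a b : ℝ} (hab : a < b) {f : ℝ → ℝ} (hf : Continuous f)
    (h : ∀ᵐ x ∂(volume.restrict (Ioo a b)), 0 ≤ f x) : ∀ x ∈ Icc a b, 0 ≤ f x := by
  have hU : IsOpen (Ioo a b ∩ {x | f x < 0}) := isOpen_Ioo.inter (isOpen_lt hf continuous_const)
  have h0 : volume (Ioo a b ∩ {x | f x < 0}) = 0 := by
    rw [ae_restrict_iff' measurableSet_Ioo, ae_iff] at h
    refine measure_mono_null (fun x hx => ?_) h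
    exact fun hcon => not_lt.2 (hcon hx.1) hx.2
  have hemp := (hU.measure_eq_zero_iff volume).1 h0
  have hsub : Ioo a b ⊆ {x | 0 ≤ f x} := fun x hx => by
    by_contra hneg
    exact notMem_empty x (hemp.subset ⟨hx, show f x < 0 from lt_of_not_ge hneg⟩)
  have := closure_minimal hsub (isClosed_le continuous_const hf)
  rwa [closure_Ioo hab.ne] at this

theorem half_tsum_le_integral_abs_of_nonneg {a b s : ℝ} (hab : a < b) (hs : s ∈ Ioo (0 : ℝ) 1)
    {v : ℝ → ℝ} (hv : MemHN a b (2 * s + 1) v)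
    (hv0 : ∀ᵐ x ∂(volume.restrict (Ioo a b)), 0 ≤ v x) :
    1 / (2 * (b - a)) * ∑' k, neumannEigenvalue a b k ^ s * neumannCoeff a b v k ^ 2 ≤
      ∫ x in Ioo a b, |v x * sineSeriesLp a b
        (fun k => -(neumannEigenvalue a b k ^ s * neumannFreq a b k * neumannCoeff a b v k)) x| := by
  have hL := sub_pos.2 hab
  obtain ⟨hvL, hc⟩ := hv
  set c := neumannCoeff a b v
  have habs := summable_abs_of_sobolev hab (by linarith [hs.1]) hc
  have hcont := continuous_cosineSeries hab habs
  have hae := ae_eq_cosineSeries hab hvL habs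
  obtain ⟨x₀, hx₀, hmin⟩ := isCompact_Icc.exists_isMinOn (nonempty_Icc.2 hab.le)
    (hcont.continuousOn (s := Icc a b))
  set m := cosineSeries a b c x₀
  have hm : 0 ≤ m := nonneg_on_Icc_of_ae hab hcont (by
    filter_upwards [hv0, hae] with x h1 h2
    rwa [← h2]) x₀ hx₀
  -- Coefficients of `v - m`: since `φ₀ = 1/√(b - a)`, the constant `m` is `m √(b - a) φ₀`.
  set c' : ℕ → ℝ := fun k => c k - if k = 0 then m * Real.sqrt (b - a) else 0 with hc'def
  have hcc : ∀ k, c' (k + 1) = c (k + 1) := fun k => by simp [hc'def]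
  have hc' : Summable fun k => c' k ^ 2 * (1 + neumannEigenvalue a b k ^ (2 * s + 1)) := by
    rw [← summable_nat_add_iff 1] at hc ⊢
    simpa only [hcc] using hc
  have hseries : ∀ x, cosineSeries a b c' x = cosineSeries a b c x - m := fun x => by
    have h1 := (summable_mul_neumannEigenfunction hab habs x).hasSum
    have h2 := hasSum_ite_eq 0 m
    have hsq : Real.sqrt (b - a) ≠ 0 := (Real.sqrt_pos.2 hL).ne'
    refine ((h1.sub h2).congr_fun fun k => ?_).tsum_eq
    rcases eq_or_ne k 0 with rfl | hk
    · simp only [hc'def, if_true, neumannEigenfunction]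
      simp
      field_simp
    · simp [hc'def, hk]
  have key := half_tsum_le_integral_abs hab hs hc' (x₀ := x₀)
    (fun x hx => by rw [hseries]; exact sub_nonneg.2 (hmin hx)) hx₀ (by rw [hseries, sub_self])
  -- The modified coefficient is weighted by `0 ^ s`, which is `0` because `s > 0`.
  have e1 : ∀ k, neumannEigenvalue a b k ^ s * c' k ^ 2 = neumannEigenvalue a b k ^ s * c k ^ 2 :=
    fun k => by
      rcases k with _ | k
      · simp [neumannEigenvalue_zero, Real.zero_rpow hs.1.ne']
      · rw [hcc]
  have e2 : ∀ k, -(neumannEigenvalue a b k ^ s * neumannFreq a b k * c' k) =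
      -(neumannEigenvalue a b k ^ s * neumannFreq a b k * c k) := fun k => by
    rcases k with _ | k
    · simp [neumannFreq_zero]
    · rw [hcc]
  simp_rw [e1, e2] at key
  refine key.trans ?_
  set h := sineSeriesLp a b fun k => -(neumannEigenvalue a b k ^ s * neumannFreq a b k * c k)
  have hcont' := continuous_cosineSeries hab (summable_abs_of_sobolev hab (by linarith [hs.1]) hc')
  refine integral_mono_ae
    ((memLp_two_of_continuous a b hcont').integrable_mul (Lp.memLp h)).abs
    (hvL.integrable_mul (Lp.memLp h)).abs ?_
  filter_upwards [hae, ae_restrict_mem measurableSet_Ioo] with x hx hxI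
  have h1 : 0 ≤ cosineSeries a b c x - m := sub_nonneg.2 (hmin (Ioo_subset_Icc_self hxI))
  simp only [abs_mul]
  refine mul_le_mul_of_nonneg_right ?_ (abs_nonneg _)
  rw [hseries, hx, abs_of_nonneg h1, abs_of_nonneg (by linarith)]
  linarith

theorem lemma3p4 (a b s : ℝ) (hab : a < b) (hs0 : 0 < s) (hs1 : s < 1)
    (v : ℝ → ℝ) (hv : MemHN a b (2 * s + 1) v)
    (hv0 : ∀ᵐ x ∂(volume.restrict (Ioo a b)), 0 ≤ v x) :
    (∃ h : ℝ → ℝ, MemLp h 2 (volume.restrict (Ioo a b)) ∧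
      HasWeakDerivOn a b (neumannFracLaplacian a b s v) h) ∧
    ∀ h : ℝ → ℝ, HasWeakDerivOn a b (neumannFracLaplacian a b s v) h →
      ∀ w : ℝ → ℝ≥0, AEMeasurable w (volume.restrict (Ioo a b)) →
        -- the product on the right below is not of the indeterminate form `∞ · 0`
        ((∫⁻ x in Ioo a b, ENNReal.ofReal (v x ^ 2) / (w x : ℝ≥0∞)) ≠ ⊤ ∨
          (∫⁻ x in Ioo a b, (w x : ℝ≥0∞) * ENNReal.ofReal (h x ^ 2)) ≠ 0) →
        ENNReal.ofReal (1 / (4 * (b - a) ^ 2) *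
            (∫ x in Ioo a b, |neumannFracLaplacian a b (s / 2) v x| ^ 2) ^ 2) ≤
          (∫⁻ x in Ioo a b, ENNReal.ofReal (v x ^ 2) / (w x : ℝ≥0∞)) *
            ∫⁻ x in Ioo a b, (w x : ℝ≥0∞) * ENNReal.ofReal (h x ^ 2) := by
  have hL := sub_pos.2 hab
  have hl := neumannEigenvalue_nonneg a b
  have hpow : ∀ k (q : ℝ), (neumannEigenvalue a b k ^ q * neumannCoeff a b v k) ^ 2 =
      neumannCoeff a b v k ^ 2 * neumannEigenvalue a b k ^ (2 * q) := fun k q => by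
    rw [mul_pow, mul_comm 2 q, Real.rpow_mul (hl k), Real.rpow_two]
    ring
  have hsq : ∀ q : ℝ, 0 ≤ q → q ≤ s → Summable fun k =>
      (neumannEigenvalue a b k ^ q * neumannCoeff a b v k) ^ 2 := fun q hq hqs => by
    simp_rw [hpow]
    exact summable_sq_mul_rpow hv.2 (by linarith) (by linarith)
  have hder := hasWeakDerivOn_neumannFracLaplacian hab (hsq s hs0.le le_rfl)
    ((summable_sq_mul_rpow hv.2 (by linarith) le_rfl).congr fun k => by
      rw [neg_sq, sq_rpow_mul a b s _ hs0 k])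
  have hvirial := half_tsum_le_integral_abs_of_nonneg hab ⟨hs0, hs1⟩ hv hv0
  set h₀ := sineSeriesLp a b fun k =>
    -(neumannEigenvalue a b k ^ s * neumannFreq a b k * neumannCoeff a b v k)
  refine ⟨⟨h₀, Lp.memLp h₀, hder⟩, fun h hh w hw hind => ?_⟩
  have hae := hh.ae_eq hder
  -- If the first integral is infinite, excluding `∞ · 0` makes the product `⊤`; otherwise
  -- Cauchy–Schwarz applies, also when the second integral is infinite.
  by_cases hA : (∫⁻ x in Ioo a b, ENNReal.ofReal (v x ^ 2) / (w x : ℝ≥0∞)) = ⊤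
  · rw [hA, ENNReal.top_mul (hind.resolve_left (not_not.2 hA))]
    exact le_top
  refine le_trans ?_ (lintegral_mul_sq_le_weighted hv.1.1.aemeasurable
    ((Lp.memLp h₀).1.aemeasurable.congr hae.symm) hw hA)
  have hE : ∫ x in Ioo a b, |neumannFracLaplacian a b (s / 2) v x| ^ 2 =
      ∑' k, neumannEigenvalue a b k ^ s * neumannCoeff a b v k ^ 2 := by
    rw [integral_sq_neumannFracLaplacian hab (hsq _ (by linarith) (by linarith))]
    refine tsum_congr fun k => ?_
    rw [hpow, mul_div_cancel₀ s two_ne_zero, mul_comm]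
  have hE0 : 0 ≤ ∑' k, neumannEigenvalue a b k ^ s * neumannCoeff a b v k ^ 2 :=
    tsum_nonneg fun k => mul_nonneg (Real.rpow_nonneg (hl k) _) (sq_nonneg _)
  have hI : ∫⁻ x in Ioo a b, ENNReal.ofReal |v x * h x| =
      ENNReal.ofReal (∫ x in Ioo a b, |v x * h₀ x|) := by
    refine Eq.trans (lintegral_congr_ae ?_) (ofReal_integral_eq_lintegral_ofReal
      (hv.1.integrable_mul (Lp.memLp h₀)).abs (.of_forall fun x => abs_nonneg _)).symm
    filter_upwards [hae] with x hx
    rw [hx, Pi.mul_apply]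
  rw [hI, hE, ← ENNReal.ofReal_pow (integral_nonneg fun x => abs_nonneg _)]
  refine ENNReal.ofReal_le_ofReal (le_of_eq_of_le ?_ (pow_le_pow_left₀ ?_ hvirial 2))
  · field_simp
    ring
  · positivity
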